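/- **Conventions.** An SKT Lie algebra is a triple $(\mathfrak g,g,J)$, where $\mathfrak g$ is a finite-dimensional real Lie algebra, $g$ is a Euclidean metric on $\mathfrak g$ and $J$ is a $g$-orthogonal integrable complex structure on $\mathfrak g$, such that the three-form $c=-J^*d\sigma$, $\sigma=g(J\cdot,\cdot)$, is closed. It is two-step solvable if $\mathfrak g'=[\mathfrak g,\mathfrak g]$ is Abelian; $\mathfrak g'$ is complex if $\mathfrak g'\cap J\mathfrak g'=\mathfrak g'$. Isomorphisms of such triples are isometric Lie algebra isomorphisms commuting with the complex structures. **The triples $\mathfrak g_{f,h,\alpha}$.** Let $\mathfrak a_J$ be a complex vector space with basis $Y_1,\dots,Y_m$, let $\mathfrak a_r$ be a finite-dimensional real vector space, and let $I_0\colon\mathfrak a_r\to U_r$ be an isomorphism onto a copy of $\mathfrak a_r$. Let $f\colon\mathfrak a_r\times\mathfrak a_r\to\mathfrak a_r$ be symmetric bilinear with $f(f(\cdot,\cdot),\cdot)$ totally symmetric, let $h=\sum_i h^iY_i\colon\mathfrak a_r\times\mathfrak a_r\to\mathfrak a_J$ be real bilinear with skew part $h_2(X,W)=\tfrac12(h(X,W)-h(W,X))$,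 and let $\alpha_1,\dots,\alpha_m\colon\mathfrak a_r\to\mathbb C$ be real linear. On $\mathfrak a_J\oplus\mathfrak a_r\oplus U_r$ take the skew bilinear bracket that vanishes on $\mathfrak a_J\oplus\mathfrak a_r$ and satisfies $$[I_0X,Y_i]=\alpha_i(X)Y_i,\quad [I_0X,W]=f(X,W)+h(X,W),\quad [I_0X,I_0W]=2i\,h_2(X,W)$$ for $X,W\in\mathfrak a_r$, complex linearly in the argument from $\mathfrak a_J$; the almost complex structure $I(Y+X+I_0Z)=iY-Z+I_0X$; and a Euclidean metric $\tilde g$ for which $Y_1,\dots,Y_m,iY_1,\dots,iY_m$ is an orthonormal basis of $\mathfrak a_J$, $\mathfrak a_J\perp\mathfrak a_r\oplus U_r$, and $\tilde g(X,W)=\tilde g(I_0X,I_0W)=g_0(X,W)$, $\tilde g(I_0X,W)=-\tilde g(X,I_0W)=\tau_0(X,W)$ for a symmetric form $g_0$ and a skew form $\tau_0$ on $\mathfrak a_r$ (any such forms making $\tilde g$ positive definite). The triple so obtained is denoted $\mathfrak g_{f,h,\alpha}$. **Theorem.** Let $(\mathfrak g,g,J)$ be a two-step solvable $2n$-dimensional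 SKT Lie algebra with $\mathfrak g'$ non-complex and of codimension two. Then $n\ge2$ and $(\mathfrak g,g,J)$ is isomorphic to some $\mathfrak g_{f,h,\alpha}$ with $m=n-2$, where $\mathfrak a_r$ has an orthonormal basis $(X_1,X_2)$ with $f(X_1,X_j)=aX_j$ for $j=1,2$ and $f(X_2,X_2)=b_1X_1+b_2X_2$ for certain $a>0$, $b_1\in\mathbb R$, $b_2\ge0$, where $$2a(a-b_1)+\|h(X_1,X_2)-h(X_2,X_1)\|^2+\|h(X_1,X_2)\|^2+\|h(X_2,X_1)\|^2-2\tilde g\bigl(h(X_1,X_1),h(X_2,X_2)\bigr)=0,$$ and where, for each $i=1,\dots,n-2$, the numbers $z_i=\alpha_i(X_1)$, $w_i=\alpha_i(X_2)\in\mathbb C$ satisfy one of the following: 1. $\operatorname{Re}z_i=0$, $\operatorname{Re}w_i=0$, $z_i\ne0$ and $$h^i(X_2,X_1)=h^i(X_1,X_2)=\frac{w_i}{z_i}h^i(X_1,X_1),\qquad h^i(X_2,X_2)=\frac{w_i^2-b_2w_i-b_1z_i}{z_i(z_i-a)}h^i(X_1,X_1);$$ 2. $z_i=0$, $\operatorname{Re}w_i=0$,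 $w_i\ne0$ and $$h^i(X_1,X_1)=0,\qquad h^i(X_2,X_1)=h^i(X_1,X_2),\qquad h^i(X_2,X_2)=\frac{b_2-w_i}{a}h^i(X_1,X_2);$$ 3. $\operatorname{Re}z_i=-a/2$, $x=\operatorname{Re}w_i$ solves $2x^2+b_2x-\tfrac{b_1}{2}a=0$ and $$h^i(X_1,X_2)=\frac{\overline{w}_i}{\overline{z}_i}h^i(X_1,X_1),\qquad h^i(X_2,X_1)=\frac{w_i\overline{z}_i-a\overline{w}_i}{|z_i|^2-a\overline{z}_i}h^i(X_1,X_1),$$ $$h^i(X_2,X_2)=\frac{|w_i|^2-b_1\overline{z}_i-b_2\overline{w}_i}{|z_i|^2-a\overline{z}_i}h^i(X_1,X_1).$$ The third case can only occur if $b_1\ge-b_2^2/(4a)$. Conversely, every such $\mathfrak g_{f,h,\alpha}$ is a $2n$-dimensional two-step solvable SKT Lie algebra with derived algebra non-complex and of codimension two. -/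

import Mathlib

open scoped ComplexConjugate

namespace SKT

section Geometry

variable {L : Type*} [LieRing L] [LieAlgebra ℝ L]

/-- The Chevalley–Eilenberg differential of a two-form. -/
def extDeriv₂ (β : L → L → ℝ) (x y z : L) : ℝ :=
  -β ⁅x, y⁆ z + β ⁅x, z⁆ y - β ⁅y, z⁆ x

/-- The Chevalley–Eilenberg differential of a three-form. -/
def extDeriv₃ (γ : L → L → L → ℝ) (x y z w : L) : ℝ :=
  -γ ⁅x, y⁆ z w + γ ⁅x, z⁆ y w - γ ⁅x, w⁆ y z
    - γ ⁅y, z⁆ x w + γ ⁅y, w⁆ x z - γ ⁅z, w⁆ x y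

/-- The fundamental two-form `σ = g(J·,·)`. -/
def fundamentalForm (g : LinearMap.BilinForm ℝ L) (J : L →ₗ[ℝ] L) (x y : L) : ℝ :=
  g (J x) y

/-- The torsion three-form `c = -J^* dσ`. -/
def torsionForm (g : LinearMap.BilinForm ℝ L) (J : L →ₗ[ℝ] L) (x y z : L) : ℝ :=
  -extDeriv₂ (fundamentalForm g J) (J x) (J y) (J z)

/-- `(g, J)` is a Hermitian structure on the Lie algebra `L`: `g` is a Euclidean metric and `J` is
a `g`-orthogonal integrable almost complex structure (vanishing Nijenhuis tensor). -/
structure IsHermitian (g : LinearMap.BilinForm ℝ L) (J : L →ₗ[ℝ] L) : Prop where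
  symm : ∀ x y, g x y = g y x
  pos : ∀ x, x ≠ 0 → 0 < g x x
  sq : ∀ x, J (J x) = -x
  orthogonal : ∀ x y, g (J x) (J y) = g x y
  integrable : ∀ x y, ⁅J x, J y⁆ - J ⁅J x, y⁆ - J ⁅x, J y⁆ - ⁅x, y⁆ = 0

/-- `(g, J)` is an SKT structure: Hermitian with closed torsion three-form. -/
structure IsSKT (g : LinearMap.BilinForm ℝ L) (J : L →ₗ[ℝ] L) : Prop
    extends IsHermitian g J where
  torsion_closed : ∀ x y z w, extDeriv₃ (torsionForm g J) x y z w = 0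

/-- A subspace `V` is complex if `V = V ∩ JV`. -/
def IsComplexSubspace (J : L →ₗ[ℝ] L) (V : Submodule ℝ L) : Prop :=
  V ⊓ V.map J = V

variable (L) in
/-- The derived algebra `𝔤' = [𝔤, 𝔤]` as a subspace. -/
def derivedSubspace : Submodule ℝ L :=
  (LieAlgebra.derivedSeries ℝ L 1).toSubmodule

/-- `(L, g, J)` is a two-step solvable SKT Lie algebra (`[𝔤', 𝔤'] = 0`) whose derived algebra is
non-complex and of codimension two. -/
structure IsTwoStepSKTNonComplexCodimTwo (g : LinearMap.BilinForm ℝ L) (J : L →ₗ[ℝ] L) : Prop where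
  skt : IsSKT g J
  two_step : LieAlgebra.derivedSeries ℝ L 2 = ⊥
  non_complex : ¬ IsComplexSubspace J (derivedSubspace L)
  codim_two : Module.finrank ℝ (L ⧸ derivedSubspace L) = 2

/-- Isomorphism of Lie algebras with almost Hermitian structure: a Lie algebra isomorphism that
is isometric and intertwines the almost complex structures. -/
def AreIsomorphic {L' : Type*} [LieRing L'] [LieAlgebra ℝ L']
    (g : LinearMap.BilinForm ℝ L) (J : L →ₗ[ℝ] L)
    (g' : LinearMap.BilinForm ℝ L') (J' : L' →ₗ[ℝ] L') : Prop :=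
  ∃ e : L ≃ₗ⁅ℝ⁆ L', (∀ x y, g' (e x) (e y) = g x y) ∧ ∀ x, e (J x) = J' (e x)

end Geometry

/-- The vector space `𝔞_J ⊕ 𝔞_r ⊕ U_r`, where `𝔞_J = ℂ^m` with its standard basis `Y_1, …, Y_m`,
`𝔞_r = V` and `U_r = V`. The triple `(y, x, u)` stands for `y + x + I₀ u`. -/
abbrev Space (m : ℕ) (V : Type*) : Type _ := (Fin m → ℂ) × V × V

/-- The defining data of `𝔤_{f,h,α}`. The bilinear map `h` is the sum of its symmetric part `h₁`
and its skew part `h₂`. -/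
structure Data (m : ℕ) (V : Type*) [AddCommGroup V] [Module ℝ V] where
  f : V →ₗ[ℝ] V →ₗ[ℝ] V
  h : V →ₗ[ℝ] V →ₗ[ℝ] (Fin m → ℂ)
  α : Fin m → V →ₗ[ℝ] ℂ
  g₀ : LinearMap.BilinForm ℝ V
  τ₀ : LinearMap.BilinForm ℝ V
  f_symm : ∀ x y, f x y = f y x
  f_f_symm : ∀ x y z, f (f x y) z = f (f x z) y
  g₀_symm : ∀ x y, g₀ x y = g₀ y x
  τ₀_skew : ∀ x y, τ₀ x y = -τ₀ y x
  /-- The symmetric form on `𝔞_r ⊕ U_r` determined by `g₀` and `τ₀` is positive definite. -/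
  pos : ∀ x u, (x ≠ 0 ∨ u ≠ 0) → 0 < g₀ x x + g₀ u u + 2 * τ₀ u x

namespace Data

variable {m : ℕ} {V : Type*} [AddCommGroup V] [Module ℝ V] (D : Data m V)

/-- The skew part `h₂` of `h`. -/
noncomputable def h₂ (x y : V) : Fin m → ℂ := (1 / 2 : ℂ) • (D.h x y - D.h y x)

/-- The skew-symmetric bilinear bracket with `[I₀ X, Y_i] = α_i(X) Y_i` (complex linear in the
second entry), `[I₀ X, W] = f(X, W) + h(X, W)`, `[I₀ X, I₀ W] = 2 i h₂(X, W)`, and zero on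
`𝔞_J ⊕ 𝔞_r`. -/
noncomputable def bracket (p q : Space m V) : Space m V :=
  (fun i => D.α i p.2.2 * q.1 i - D.α i q.2.2 * p.1 i
      + D.h p.2.2 q.2.1 i - D.h q.2.2 p.2.1 i
      + 2 * Complex.I * D.h₂ p.2.2 q.2.2 i,
    D.f p.2.2 q.2.1 - D.f q.2.2 p.2.1,
    0)

/-- The bracket satisfies the Jacobi identity. -/
def Jacobi : Prop :=
  ∀ p q r : Space m V,
    D.bracket p (D.bracket q r) = D.bracket (D.bracket p q) r + D.bracket q (D.bracket p r)

/-- The real inner product on `𝔞_J` for which `Y_1, …, Y_m, iY_1, …, iY_m` is orthonormal. -/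
noncomputable def innerJ (y y' : Fin m → ℂ) : ℝ := ∑ i, (conj (y i) * y' i).re

theorem bracket_add_left (p q r : Space m V) :
    D.bracket (p + q) r = D.bracket p r + D.bracket q r := by
  refine Prod.ext (funext fun i => ?_) (Prod.ext ?_ ?_)
  · simp [bracket, h₂]; ring
  · simp [bracket]; abel
  · simp [bracket]

theorem bracket_add_right (p q r : Space m V) :
    D.bracket p (q + r) = D.bracket p q + D.bracket p r := by
  refine Prod.ext (funext fun i => ?_) (Prod.ext ?_ ?_)
  · simp [bracket, h₂]; ring
  · simp [bracket]; abel
  · simp [bracket]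

theorem bracket_self (p : Space m V) : D.bracket p p = 0 := by
  refine Prod.ext (funext fun i => ?_) (Prod.ext ?_ ?_) <;> simp [bracket, h₂]

theorem bracket_smul_right (t : ℝ) (p q : Space m V) :
    D.bracket p (t • q) = t • D.bracket p q := by
  refine Prod.ext (funext fun i => ?_) (Prod.ext ?_ ?_)
  · simp [bracket, h₂]; ring
  · simp [bracket, smul_sub]
  · simp [bracket]

/-- The metric: `𝔞_J` is orthogonal to `𝔞_r ⊕ U_r`, and on the latter
`g(X, W) = g(I₀X, I₀W) = g₀(X, W)`, `g(I₀X, W) = -g(X, I₀W) = τ₀(X, W)`. -/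
noncomputable def spaceMetric : LinearMap.BilinForm ℝ (Space m V) :=
  LinearMap.mk₂ ℝ
    (fun p q => innerJ p.1 q.1 + D.g₀ p.2.1 q.2.1 + D.g₀ p.2.2 q.2.2
      + D.τ₀ p.2.2 q.2.1 + D.τ₀ q.2.2 p.2.1)
    (by intro p q r; simp [innerJ, add_mul, Finset.sum_add_distrib]; ring)
    (by intro t p q; simp [innerJ, Finset.mul_sum, mul_add, mul_assoc])
    (by intro p q r; simp [innerJ, mul_add, Finset.sum_add_distrib]; ring)
    (by intro t p q; simp [innerJ, Finset.mul_sum, mul_add, mul_left_comm])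

/-- The almost complex structure `I (Y + X + I₀ Z) = iY - Z + I₀ X`. -/
noncomputable def spaceI (m : ℕ) (V : Type*) [AddCommGroup V] [Module ℝ V] :
    Space m V →ₗ[ℝ] Space m V where
  toFun p := (Complex.I • p.1, -p.2.2, p.2.1)
  map_add' p q := by
    refine Prod.ext (funext fun i => ?_) (Prod.ext ?_ ?_)
    · simp; ring
    · simp; abel
    · simp
  map_smul' t p := by
    refine Prod.ext (funext fun i => ?_) (Prod.ext ?_ ?_)
    · simp; ring
    · simp
    · simp

/-- The Lie algebra `𝔤_{f,h,α}`, defined once the Jacobi identity is known. -/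
def Model (_hJ : D.Jacobi) : Type _ := Space m V

variable {D} (hJ : D.Jacobi)

instance : AddCommGroup (D.Model hJ) := inferInstanceAs (AddCommGroup (Space m V))

noncomputable instance : Module ℝ (D.Model hJ) := inferInstanceAs (Module ℝ (Space m V))

noncomputable instance : LieRing (D.Model hJ) where
  bracket p q := D.bracket p q
  add_lie := D.bracket_add_left
  lie_add := D.bracket_add_right
  lie_self := D.bracket_self
  leibniz_lie := hJ

noncomputable instance : LieAlgebra ℝ (D.Model hJ) where
  lie_smul := D.bracket_smul_right

/-- The metric of `𝔤_{f,h,α}`. -/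
noncomputable def metric : LinearMap.BilinForm ℝ (D.Model hJ) := D.spaceMetric

/-- The almost complex structure of `𝔤_{f,h,α}`. -/
noncomputable def complexStructure : D.Model hJ →ₗ[ℝ] D.Model hJ := spaceI m V

end Data

section NormalForm

variable {m : ℕ} {V : Type*} [AddCommGroup V] [Module ℝ V]

/-- First case, for a single index `i`, with `h₁₁ = h^i(X_1, X_1)` etc. -/
def CaseI (a b₁ b₂ : ℝ) (z w h₁₁ h₁₂ h₂₁ h₂₂ : ℂ) : Prop :=
  z.re = 0 ∧ w.re = 0 ∧ z ≠ 0 ∧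
    h₂₁ = h₁₂ ∧ h₁₂ = w / z * h₁₁ ∧
    h₂₂ = (w ^ 2 - b₂ * w - b₁ * z) / (z * (z - a)) * h₁₁

/-- Second case. -/
def CaseII (a b₂ : ℝ) (z w h₁₁ h₁₂ h₂₁ h₂₂ : ℂ) : Prop :=
  z = 0 ∧ w.re = 0 ∧ w ≠ 0 ∧
    h₁₁ = 0 ∧ h₂₁ = h₁₂ ∧ h₂₂ = (b₂ - w) / a * h₁₂

/-- Third case. -/
def CaseIII (a b₁ b₂ : ℝ) (z w h₁₁ h₁₂ h₂₁ h₂₂ : ℂ) : Prop :=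
  z.re = -a / 2 ∧ 2 * w.re ^ 2 + b₂ * w.re - b₁ / 2 * a = 0 ∧
    h₁₂ = conj w / conj z * h₁₁ ∧
    h₂₁ = (w * conj z - a * conj w) / ((‖z‖ : ℂ) ^ 2 - a * conj z) * h₁₁ ∧
    h₂₂ = ((‖w‖ : ℂ) ^ 2 - b₁ * conj z - b₂ * conj w) / ((‖z‖ : ℂ) ^ 2 - a * conj z) * h₁₁

/-- The data `D` are in the normal form with parameters `a, b₁, b₂, z, w` with respect to the
basis `(X_1, X_2) = (X 0, X 1)` of `𝔞_r`. -/
structure IsNormalForm (D : Data m V) (X : Module.Basis (Fin 2) ℝ V)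
    (a b₁ b₂ : ℝ) (z w : Fin m → ℂ) : Prop where
  orthonormal : ∀ j k, D.g₀ (X j) (X k) = if j = k then 1 else 0
  a_pos : 0 < a
  b₂_nonneg : 0 ≤ b₂
  f_X₁ : ∀ j, D.f (X 0) (X j) = a • X j
  f_X₂ : D.f (X 1) (X 1) = b₁ • X 0 + b₂ • X 1
  α_X₁ : ∀ i, D.α i (X 0) = z i
  α_X₂ : ∀ i, D.α i (X 1) = w i
  norm_condition :
    2 * a * (a - b₁)
      + Data.innerJ (D.h (X 0) (X 1) - D.h (X 1) (X 0)) (D.h (X 0) (X 1) - D.h (X 1) (X 0))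
      + Data.innerJ (D.h (X 0) (X 1)) (D.h (X 0) (X 1))
      + Data.innerJ (D.h (X 1) (X 0)) (D.h (X 1) (X 0))
      - 2 * Data.innerJ (D.h (X 0) (X 0)) (D.h (X 1) (X 1)) = 0
  cases : ∀ i,
    CaseI a b₁ b₂ (z i) (w i) (D.h (X 0) (X 0) i) (D.h (X 0) (X 1) i)
      (D.h (X 1) (X 0) i) (D.h (X 1) (X 1) i) ∨
    CaseII a b₂ (z i) (w i) (D.h (X 0) (X 0) i) (D.h (X 0) (X 1) i)
      (D.h (X 1) (X 0) i) (D.h (X 1) (X 1) i) ∨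
    CaseIII a b₁ b₂ (z i) (w i) (D.h (X 0) (X 0) i) (D.h (X 0) (X 1) i)
      (D.h (X 1) (X 0) i) (D.h (X 1) (X 1) i)

end NormalForm

end SKT

/-!
A parity count gives `𝔤' = 𝔞_J ⊕ 𝔞_r` with `𝔞_J = 𝔤' ∩ J𝔤'` and `dim 𝔞_r = 2`, so that
`𝔤 = 𝔞_J ⊕ 𝔞_r ⊕ J𝔞_r`. The operators `ad (JX)` on `𝔞_J`, for `X` in `𝔞_r`, are complex linear and
commute. Closedness of the torsion makes the self-commutator of each such operator `A` commute with
`A + A^*`, and a trace argument then shows that `A` is normal. The operators are therefore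
simultaneously unitarily diagonalizable, which yields the `Y_i` and the `α_i`. The
`𝔞_r`-component `f` of `[JX, W]` is a commutative associative product whose values span `𝔞_r`, so it
has a unit, and `X_1` is the unit rescaled to length one.

In these coordinates the Jacobi identity and the closedness of the torsion become one equation on
the total length of `h` together with finitely many scalar equations for each index `i`. The latter
force `Re z_i ∈ {0, -a/2}` and, once `z_i` and `w_i` are fixed, are linear in the components of
`h^i`; the three cases are their solutions. Read backwards, the same equivalences give the converse,
since an alternating four-form vanishes as soon as it does on generators.
-/

namespace SKT

/-! ### Alternating forms -/

section AlternatingMaps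

variable {R M N : Type*} [CommRing R] [AddCommGroup M] [Module R M] [AddCommGroup N] [Module R N]
  {n : ℕ}

/-- The alternating map `T` vanishes on tuples of vectors of the subspace `W`. -/
def VanishesOn (T : M [⋀^Fin n]→ₗ[R] N) (W : Submodule R M) : Prop :=
  ∀ ⦃v : Fin n → M⦄, (∀ i, v i ∈ W) → T v = 0

theorem VanishesOn.curryLeft {T : M [⋀^Fin (n + 1)]→ₗ[R] N} {W : Submodule R M}
    (hT : VanishesOn T W) {x : M} (hx : x ∈ W) : VanishesOn (T.curryLeft x) W :=
  fun _ hv => hT (Fin.cases hx hv)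

theorem vanishesOn_of_apply_empty {T : M [⋀^Fin 0]→ₗ[R] N} {W : Submodule R M} (hT : T ![] = 0) :
    VanishesOn T W :=
  fun v _ => by rw [Matrix.empty_eq v, hT]

theorem vanishesOn_of_curryLeft {T : M [⋀^Fin (n + 1)]→ₗ[R] N} {W : Submodule R M}
    (hT : ∀ x ∈ W, VanishesOn (T.curryLeft x) W) : VanishesOn T W := by
  intro v hv
  rw [← Matrix.cons_head_tail v]
  exact hT _ (hv 0) fun i => hv i.succ

theorem curryLeft_curryLeft_swap (T : M [⋀^Fin (n + 2)]→ₗ[R] N) (x y : M) :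
    (T.curryLeft x).curryLeft y = -(T.curryLeft y).curryLeft x := by
  have h := AlternatingMap.curryLeft_same T (x + y)
  simp only [map_add, AlternatingMap.curryLeft_add, LinearMap.add_apply,
    AlternatingMap.curryLeft_same, zero_add, add_zero] at h
  exact eq_neg_of_add_eq_zero_right h

theorem vanishesOn_sup_span_of_curryLeft {T : M [⋀^Fin (n + 1)]→ₗ[R] N} {W : Submodule R M}
    {e : M} (hW : ∀ w ∈ W, VanishesOn (T.curryLeft w) (W ⊔ Submodule.span R {e}))
    (he : VanishesOn (T.curryLeft e) (W ⊔ Submodule.span R {e})) :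
    VanishesOn T (W ⊔ Submodule.span R {e}) := by
  intro v hv
  obtain ⟨w, hw, _, hte, hwe⟩ := Submodule.mem_sup.1 (hv 0)
  obtain ⟨t, rfl⟩ := Submodule.mem_span_singleton.1 hte
  have htail : ∀ i, Fin.tail v i ∈ W ⊔ Submodule.span R {e} := fun i => hv i.succ
  calc T v = T.curryLeft (w + t • e) (Fin.tail v) := by
        rw [hwe, AlternatingMap.curryLeft_apply_apply]
        exact congrArg T (Fin.cons_self_tail v).symm
    _ = 0 := by
        rw [map_add, map_smul, AlternatingMap.add_apply, AlternatingMap.smul_apply,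
          hW w hw htail, he htail, smul_zero, add_zero]

theorem VanishesOn.sup_span_singleton {T : M [⋀^Fin (n + 1)]→ₗ[R] N} {W : Submodule R M} {e : M}
    (hT : VanishesOn T W) (he : VanishesOn (T.curryLeft e) W) :
    VanishesOn T (W ⊔ Submodule.span R {e}) := by
  induction n with
  | zero =>
    exact vanishesOn_sup_span_of_curryLeft (fun w hw _ _ => hT.curryLeft hw finZeroElim)
      fun _ _ => he finZeroElim
  | succ n ih =>
    refine vanishesOn_sup_span_of_curryLeft (fun w hw => ih (hT.curryLeft hw) ?_) (ih he ?_)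
    · intro v hv
      rw [curryLeft_curryLeft_swap, AlternatingMap.neg_apply, he.curryLeft hw hv, neg_zero]
    · intro v _
      rw [AlternatingMap.curryLeft_same, AlternatingMap.zero_apply]
end AlternatingMaps

section Torsion

variable {L : Type*} [LieRing L] [LieAlgebra ℝ L]
  {g : LinearMap.BilinForm ℝ L} {J : L →ₗ[ℝ] L}

theorem torsionForm_eq (horth : ∀ x y, g (J x) (J y) = g x y) (x y z : L) :
    torsionForm g J x y z = g ⁅J x, J y⁆ z + g ⁅J y, J z⁆ x + g ⁅J z, J x⁆ y := by
  rw [← lie_skew (J z) (J x)]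
  simp only [torsionForm, extDeriv₂, fundamentalForm, horth, map_neg, LinearMap.neg_apply]
  ring

/-- The torsion three-form as an alternating map. -/
def torsionAlternating (horth : ∀ x y, g (J x) (J y) = g x y) : L [⋀^Fin 3]→ₗ[ℝ] ℝ where
  toFun v := torsionForm g J (v 0) (v 1) (v 2)
  map_update_add' {inst} v i x y := by
    obtain rfl : inst = instDecidableEqFin 3 := Subsingleton.elim _ _
    fin_cases i <;> simp [torsionForm_eq horth] <;> ring
  map_update_smul' {inst} v i t x := by
    obtain rfl : inst = instDecidableEqFin 3 := Subsingleton.elim _ _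
    fin_cases i <;> simp [torsionForm_eq horth] <;> ring
  map_eq_zero_of_eq' v i j hv hij := by
    have skew (x y z : L) : g ⁅J x, J y⁆ z = -g ⁅J y, J x⁆ z := by
      rw [← lie_skew, map_neg, LinearMap.neg_apply]
    fin_cases i <;> fin_cases j <;> grind [torsionForm_eq]

section

variable (horth : ∀ x y, g (J x) (J y) = g x y)
include horth

theorem torsionForm_swap_left (x y z : L) : torsionForm g J x y z = -torsionForm g J y x z :=
  (torsionAlternating horth).map_swap ![y, x, z] zero_ne_one

theorem torsionForm_swap_right (x y z : L) : torsionForm g J x y z = -torsionForm g J x z y :=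
  (torsionAlternating horth).map_swap ![x, z, y] (by decide : (1 : Fin 3) ≠ 2)

theorem torsionForm_zero_left (y z : L) : torsionForm g J 0 y z = 0 :=
  (torsionAlternating horth).map_coord_zero (m := ![0, y, z]) 0 rfl

end

/-- The Chevalley–Eilenberg differential of an alternating three-form. -/
def extDerivAlternating (γ : L [⋀^Fin 3]→ₗ[ℝ] ℝ) : L [⋀^Fin 4]→ₗ[ℝ] ℝ where
  toFun v := extDeriv₃ (fun x y z => γ ![x, y, z]) (v 0) (v 1) (v 2) (v 3)
  map_update_add' {inst} v i x y := by
    obtain rfl : inst = instDecidableEqFin 4 := Subsingleton.elim _ _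
    have add₀ (x x' y z : L) : γ ![x + x', y, z] = γ ![x, y, z] + γ ![x', y, z] :=
      γ.map_vecCons_add _ _ _
    have add₁ (x y y' z : L) : γ ![x, y + y', z] = γ ![x, y, z] + γ ![x, y', z] :=
      (γ.curryLeft x).map_vecCons_add _ _ _
    have add₂ (x y z z' : L) : γ ![x, y, z + z'] = γ ![x, y, z] + γ ![x, y, z'] :=
      ((γ.curryLeft x).curryLeft y).map_vecCons_add _ _ _
    fin_cases i <;> simp [extDeriv₃, add₀, add₁, add₂] <;> ring
  map_update_smul' {inst} v i t x := by
    obtain rfl : inst = instDecidableEqFin 4 := Subsingleton.elim _ _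
    have smul₀ (x y z : L) : γ ![t • x, y, z] = t * γ ![x, y, z] := γ.map_vecCons_smul _ _ _
    have smul₁ (x y z : L) : γ ![x, t • y, z] = t * γ ![x, y, z] :=
      (γ.curryLeft x).map_vecCons_smul _ _ _
    have smul₂ (x y z : L) : γ ![x, y, t • z] = t * γ ![x, y, z] :=
      ((γ.curryLeft x).curryLeft y).map_vecCons_smul _ _ _
    fin_cases i <;> simp [extDeriv₃, smul₀, smul₁, smul₂] <;> ring
  map_eq_zero_of_eq' v i j hv hij := by
    have skew_left (x y z w : L) : γ ![⁅x, y⁆, z, w] = -γ ![⁅y, x⁆, z, w] := by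
      simpa using γ.map_vecCons_smul ![z, w] (-1) ⁅y, x⁆
    have skew_right (x y z w : L) : γ ![⁅x, y⁆, z, w] = -γ ![⁅x, y⁆, w, z] :=
      AlternatingMap.congr_fun (curryLeft_curryLeft_swap (γ.curryLeft ⁅x, y⁆) z w) ![]
    fin_cases i <;> fin_cases j <;> grind [extDeriv₃]

theorem vanishesOn_extDerivAlternating_of_lie_eq_zero (γ : L [⋀^Fin 3]→ₗ[ℝ] ℝ)
    {W : Submodule ℝ L} (hW : ∀ x ∈ W, ∀ y ∈ W, ⁅x, y⁆ = 0) :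
    VanishesOn (extDerivAlternating γ) W := by
  intro v hv
  have hγ (z w : L) : γ ![0, z, w] = 0 := γ.map_coord_zero 0 rfl
  change extDeriv₃ (fun x y z => γ ![x, y, z]) (v 0) (v 1) (v 2) (v 3) = 0
  simp only [extDeriv₃, hW _ (hv _) _ (hv _), hγ, neg_zero, add_zero, sub_zero]

theorem extDeriv₃_torsionForm_eq_zero_of_vanishesOn_top
    (horth : ∀ x y, g (J x) (J y) = g x y)
    (h : VanishesOn (extDerivAlternating (torsionAlternating horth)) ⊤) (x y z w : L) :
    extDeriv₃ (torsionForm g J) x y z w = 0 :=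
  h (v := ![x, y, z, w]) fun _ => Submodule.mem_top

end Torsion

/-! ### The model -/
namespace Data

section InnerJ

variable {m : ℕ}

theorem innerJ_comm (y y' : Fin m → ℂ) : innerJ y y' = innerJ y' y := by
  refine Finset.sum_congr rfl fun i _ => ?_
  simp only [Complex.mul_re, Complex.conj_re, Complex.conj_im]
  ring

@[simp] theorem innerJ_zero_left (y : Fin m → ℂ) : innerJ 0 y = 0 := by simp [innerJ]

@[simp] theorem innerJ_zero_right (y : Fin m → ℂ) : innerJ y 0 = 0 := by simp [innerJ]

theorem innerJ_I_smul (y y' : Fin m → ℂ) :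
    innerJ (Complex.I • y) (Complex.I • y') = innerJ y y' := by
  refine Finset.sum_congr rfl fun i _ => ?_
  simp [Complex.mul_re]

theorem innerJ_self (y : Fin m → ℂ) : innerJ y y = ∑ i, Complex.normSq (y i) :=
  Finset.sum_congr rfl fun i _ => by rw [← Complex.normSq_eq_conj_mul_self, Complex.ofReal_re]

theorem innerJ_self_nonneg (y : Fin m → ℂ) : 0 ≤ innerJ y y := by
  rw [innerJ_self]
  exact Finset.sum_nonneg fun i _ => Complex.normSq_nonneg _

theorem innerJ_self_pos {y : Fin m → ℂ} (hy : y ≠ 0) : 0 < innerJ y y := by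
  obtain ⟨i, hi⟩ := Function.ne_iff.mp hy
  rw [innerJ_self]
  exact Finset.sum_pos' (fun j _ => Complex.normSq_nonneg _)
    ⟨i, Finset.mem_univ i, Complex.normSq_pos.2 hi⟩

end InnerJ

section Bracket

variable {m : ℕ} {V : Type*} [AddCommGroup V] [Module ℝ V] (D : Data m V)

theorem bracket_mk (y : Fin m → ℂ) (v u : V) (y' : Fin m → ℂ) (v' u' : V) :
    D.bracket (y, v, u) (y', v', u') =
      (fun i => D.α i u * y' i - D.α i u' * y i + D.h u v' i - D.h u' v i
        + Complex.I * (D.h u u' i - D.h u' u i), D.f u v' - D.f u' v, 0) := by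
  refine Prod.ext (funext fun i => ?_) rfl
  simp only [bracket, h₂, Pi.smul_apply, Pi.sub_apply, smul_eq_mul]
  ring

end Bracket

section Model

variable {m : ℕ} {V : Type*} [AddCommGroup V] [Module ℝ V] {D : Data m V} (hJ : D.Jacobi)

/-- The inclusion of `𝔞_J` into `𝔤_{f,h,α}`. -/
noncomputable def ofJ : (Fin m → ℂ) →ₗ[ℝ] D.Model hJ := LinearMap.inl ℝ (Fin m → ℂ) (V × V)

/-- The inclusion of `𝔞_r` into `𝔤_{f,h,α}`. -/
noncomputable def ofR : V →ₗ[ℝ] D.Model hJ :=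
  LinearMap.inr ℝ (Fin m → ℂ) (V × V) ∘ₗ LinearMap.inl ℝ V V

/-- The inclusion `I₀` of `𝔞_r` into `𝔤_{f,h,α}` as `U_r`. -/
noncomputable def ofU : V →ₗ[ℝ] D.Model hJ :=
  LinearMap.inr ℝ (Fin m → ℂ) (V × V) ∘ₗ LinearMap.inr ℝ V V

theorem eq_ofJ_add_ofR_add_ofU (x : D.Model hJ) :
    x = ofJ hJ x.1 + ofR hJ x.2.1 + ofU hJ x.2.2 := by
  change ((x.1, x.2.1, x.2.2) : Space m V) = (x.1 + 0 + 0, 0 + x.2.1 + 0, 0 + 0 + x.2.2)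
  simp only [zero_add, add_zero]

@[simp] theorem lie_ofJ_ofJ (y y' : Fin m → ℂ) : ⁅ofJ hJ y, ofJ hJ y'⁆ = 0 := by
  change D.bracket (y, 0, 0) (y', 0, 0) = (0 : Space m V)
  ext <;> simp [bracket, h₂]

@[simp] theorem lie_ofR_ofR (v v' : V) : ⁅ofR hJ v, ofR hJ v'⁆ = 0 := by
  change D.bracket (0, v, 0) (0, v', 0) = (0 : Space m V)
  ext <;> simp [bracket, h₂]

@[simp] theorem lie_ofR_ofJ (v : V) (y : Fin m → ℂ) : ⁅ofR hJ v, ofJ hJ y⁆ = 0 := by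
  change D.bracket (0, v, 0) (y, 0, 0) = (0 : Space m V)
  ext <;> simp [bracket, h₂]

@[simp] theorem lie_ofJ_ofR (v : V) (y : Fin m → ℂ) : ⁅ofJ hJ y, ofR hJ v⁆ = 0 := by
  rw [← lie_skew, lie_ofR_ofJ, neg_zero]

@[simp] theorem lie_ofU_ofJ (u : V) (y : Fin m → ℂ) :
    ⁅ofU hJ u, ofJ hJ y⁆ = ofJ hJ fun i => D.α i u * y i := by
  change D.bracket (0, 0, u) (y, 0, 0) = ((fun i => D.α i u * y i, 0, 0) : Space m V)
  ext <;> simp [bracket, h₂]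

@[simp] theorem lie_ofJ_ofU (u : V) (y : Fin m → ℂ) :
    ⁅ofJ hJ y, ofU hJ u⁆ = -ofJ hJ fun i => D.α i u * y i := by
  rw [← lie_skew, lie_ofU_ofJ]

@[simp] theorem lie_ofU_ofR (u v : V) :
    ⁅ofU hJ u, ofR hJ v⁆ = ofR hJ (D.f u v) + ofJ hJ (D.h u v) := by
  change D.bracket (0, 0, u) (0, v, 0) = ((0 + D.h u v, D.f u v + 0, 0 + 0) : Space m V)
  ext <;> simp [bracket, h₂]

@[simp] theorem lie_ofR_ofU (u v : V) :
    ⁅ofR hJ v, ofU hJ u⁆ = -ofR hJ (D.f u v) - ofJ hJ (D.h u v) := by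
  rw [← lie_skew, lie_ofU_ofR, neg_add']

@[simp] theorem lie_ofU_ofU (u u' : V) :
    ⁅ofU hJ u, ofU hJ u'⁆ = ofJ hJ (Complex.I • (D.h u u' - D.h u' u)) := by
  change D.bracket (0, 0, u) (0, 0, u') = ((Complex.I • (D.h u u' - D.h u' u), 0, 0) : Space m V)
  ext <;> simp [bracket, h₂]
  ring

@[simp] theorem complexStructure_ofJ (y : Fin m → ℂ) :
    complexStructure hJ (ofJ hJ y) = ofJ hJ (Complex.I • y) :=
  Prod.ext rfl (Prod.ext neg_zero rfl)

@[simp] theorem complexStructure_ofR (v : V) : complexStructure hJ (ofR hJ v) = ofU hJ v :=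
  Prod.ext (smul_zero _) (Prod.ext neg_zero rfl)

@[simp] theorem complexStructure_ofU (v : V) : complexStructure hJ (ofU hJ v) = -ofR hJ v :=
  Prod.ext ((smul_zero _).trans neg_zero.symm) (Prod.ext rfl neg_zero.symm)

theorem metric_apply (x x' : D.Model hJ) :
    metric hJ x x' = innerJ x.1 x'.1 + D.g₀ x.2.1 x'.2.1 + D.g₀ x.2.2 x'.2.2
      + D.τ₀ x.2.2 x'.2.1 + D.τ₀ x'.2.2 x.2.1 := rfl

theorem spaceMetric_mk (y : Fin m → ℂ) (v u : V) (y' : Fin m → ℂ) (v' u' : V) :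
    D.spaceMetric (y, v, u) (y', v', u') = innerJ y y' + D.g₀ v v' + D.g₀ u u'
      + D.τ₀ u v' + D.τ₀ u' v := rfl

@[simp] theorem metric_ofJ_ofJ (y y' : Fin m → ℂ) :
    metric hJ (ofJ hJ y) (ofJ hJ y') = innerJ y y' :=
  (spaceMetric_mk y 0 0 y' 0 0).trans (by simp)

@[simp] theorem metric_ofJ_ofR (y : Fin m → ℂ) (v : V) :
    metric hJ (ofJ hJ y) (ofR hJ v) = 0 :=
  (spaceMetric_mk y 0 0 0 v 0).trans (by simp)

@[simp] theorem metric_ofR_ofJ (y : Fin m → ℂ) (v : V) :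
    metric hJ (ofR hJ v) (ofJ hJ y) = 0 :=
  (spaceMetric_mk 0 v 0 y 0 0).trans (by simp)

@[simp] theorem metric_ofJ_ofU (y : Fin m → ℂ) (v : V) :
    metric hJ (ofJ hJ y) (ofU hJ v) = 0 :=
  (spaceMetric_mk y 0 0 0 0 v).trans (by simp)

@[simp] theorem metric_ofR_ofR (v v' : V) : metric hJ (ofR hJ v) (ofR hJ v') = D.g₀ v v' :=
  (spaceMetric_mk 0 v 0 0 v' 0).trans (by simp)

theorem metric_complexStructure (x x' : D.Model hJ) :
    metric hJ (complexStructure hJ x) (complexStructure hJ x') = metric hJ x x' := by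
  change innerJ (Complex.I • x.1) (Complex.I • x'.1) + D.g₀ (-x.2.2) (-x'.2.2)
      + D.g₀ x.2.1 x'.2.1 + D.τ₀ x.2.1 (-x'.2.2) + D.τ₀ x'.2.1 (-x.2.2) = _
  rw [metric_apply, innerJ_I_smul, D.τ₀_skew x.2.1, D.τ₀_skew x'.2.1]
  simp only [map_neg, LinearMap.neg_apply]
  ring

theorem metric_self_pos {x : D.Model hJ} (hx : x ≠ 0) : 0 < metric hJ x x := by
  rw [metric_apply]
  by_cases h : x.2.1 ≠ 0 ∨ x.2.2 ≠ 0
  · linarith [D.pos _ _ h, innerJ_self_nonneg x.1]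
  · push Not at h
    have hy : x.1 ≠ 0 := fun hy => hx (Prod.ext hy (Prod.ext h.1 h.2))
    simpa only [h.1, h.2, map_zero, add_zero] using innerJ_self_pos hy

theorem complexStructure_integrable (x x' : D.Model hJ) :
    ⁅complexStructure hJ x, complexStructure hJ x'⁆
      - complexStructure hJ ⁅complexStructure hJ x, x'⁆
      - complexStructure hJ ⁅x, complexStructure hJ x'⁆ - ⁅x, x'⁆ = 0 := by
  obtain ⟨y, v, u⟩ := x
  obtain ⟨y', v', u'⟩ := x'
  change D.bracket (spaceI m V (y, v, u)) (spaceI m V (y', v', u'))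
    - spaceI m V (D.bracket (spaceI m V (y, v, u)) (y', v', u'))
    - spaceI m V (D.bracket (y, v, u) (spaceI m V (y', v', u')))
    - D.bracket (y, v, u) (y', v', u') = (0 : Space m V)
  refine Prod.ext (funext fun i => ?_) (Prod.ext ?_ ?_)
  · simp only [bracket_mk, spaceI, LinearMap.coe_mk, AddHom.coe_mk, Pi.smul_apply, smul_eq_mul,
      map_neg, Pi.neg_apply, Prod.fst_sub, Prod.fst_zero, Pi.sub_apply, Pi.zero_apply]
    linear_combination (-D.α i u * y' i + D.α i u' * y i - D.h u v' i + D.h u' v i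
      - D.h v u' i + D.h v' u i) * Complex.I_mul_I
  · simp only [bracket_mk, spaceI, LinearMap.coe_mk, AddHom.coe_mk, map_neg, D.f_symm v u',
      D.f_symm v' u, Prod.fst_sub, Prod.snd_sub, Prod.fst_zero, Prod.snd_zero]
    abel
  · simp [bracket_mk, spaceI, D.f_symm v v', D.f_symm u u']

theorem isHermitian : IsHermitian (metric hJ) (complexStructure hJ) where
  symm x x' := by
    rw [metric_apply, metric_apply, innerJ_comm, D.g₀_symm x.2.1, D.g₀_symm x.2.2]
    ring
  pos _ := metric_self_pos hJ
  sq x := by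
    change ((Complex.I • Complex.I • x.1, -x.2.1, -x.2.2) : Space m V) = -x
    rw [smul_smul, Complex.I_mul_I, neg_one_smul]
    rfl
  orthogonal := metric_complexStructure hJ
  integrable := complexStructure_integrable hJ

end Model
end Data

theorem two_mul_ofReal_re (z : ℂ) : (2 * z.re : ℂ) = z + conj z := by
  rw [Complex.add_conj, Complex.ofReal_mul, Complex.ofReal_ofNat]

namespace Data

section Identities

variable {m : ℕ} {V : Type*} [AddCommGroup V] [Module ℝ V] {D : Data m V}

theorem eq_zero_of_forall_innerJ_eq_zero {e : Fin m → ℂ} (he : ∀ y, innerJ e y = 0) : e = 0 :=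
  by_contra fun h => (innerJ_self_pos h).ne' (he e)

theorem f_f_left_comm (D : Data m V) (x y z : V) : D.f x (D.f y z) = D.f y (D.f x z) := by
  rw [D.f_symm x, D.f_symm y z, D.f_f_symm, D.f_symm _ y, D.f_symm z x]

theorem jacobi_iff :
    D.Jacobi ↔ ∀ i u u' v, D.α i u * D.h u' v i + D.h u (D.f u' v) i =
      D.α i u' * D.h u v i + D.h u' (D.f u v) i := by
  constructor
  · intro hJ i u u' v
    have h := congrFun (congrArg Prod.fst (hJ (0, 0, u) (0, 0, u') (0, v, 0))) i
    simp only [bracket_mk, Prod.fst_add, map_zero, LinearMap.zero_apply, Pi.add_apply,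
      Pi.zero_apply, sub_zero] at h
    linear_combination h
  · rintro h ⟨y, v, u⟩ ⟨y', v', u'⟩ ⟨y₃, v₃, u₃⟩
    have cyclic : ∀ i, D.α i u * (D.h u' u₃ i - D.h u₃ u' i)
        + D.α i u' * (D.h u₃ u i - D.h u u₃ i) + D.α i u₃ * (D.h u u' i - D.h u' u i) = 0 := by
      intro i
      have h₁ := h i u u' u₃
      have h₂ := h i u' u₃ u
      have h₃ := h i u₃ u u'
      rw [D.f_symm u₃ u, D.f_symm u' u] at h₂
      rw [D.f_symm u₃ u'] at h₃
      linear_combination h₁ + h₂ + h₃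
    refine Prod.ext (funext fun i => ?_) (Prod.ext ?_ ?_)
    · simp only [bracket_mk, Prod.fst_add, map_sub, map_zero, LinearMap.zero_apply, Pi.add_apply,
        Pi.sub_apply, Pi.zero_apply]
      linear_combination h i u u' v₃ + h i u' u₃ v + h i u₃ u v' + Complex.I * cyclic i
    · simp only [bracket_mk, Prod.fst_add, Prod.snd_add, map_sub, map_zero, LinearMap.zero_apply]
      rw [D.f_f_left_comm u u' v₃, D.f_f_left_comm u u₃ v', D.f_f_left_comm u' u₃ v]
      abel
    · simp only [bracket_mk, Prod.snd_add, add_zero]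

/-- The equations on `f`, `h`, `α` and `g₀` which, given the Jacobi identity and a basis `X` of a
two-dimensional `𝔞_r`, express that the torsion of `𝔤_{f,h,α}` is closed. -/
structure PluriclosedEquations (D : Data m V) (X : Module.Basis (Fin 2) ℝ V) : Prop where
  re : ∀ i u v, 2 * (D.α i u).re * (D.α i v).re + (D.α i (D.f u v)).re = 0
  mixed : ∀ i u u' v, 2 * (D.α i v).re * (D.h u u' i - D.h u' u i) + conj (D.α i u) * D.h v u' i
    - conj (D.α i u') * D.h v u i + D.h (D.f u v) u' i - D.h (D.f u' v) u i = 0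
  norm : 2 * (D.g₀ (D.f (X 0) (X 1)) (D.f (X 0) (X 1)) - D.g₀ (D.f (X 0) (X 0)) (D.f (X 1) (X 1)))
    + innerJ (D.h (X 0) (X 1) - D.h (X 1) (X 0)) (D.h (X 0) (X 1) - D.h (X 1) (X 0))
    + innerJ (D.h (X 0) (X 1)) (D.h (X 0) (X 1)) + innerJ (D.h (X 1) (X 0)) (D.h (X 1) (X 0))
    - 2 * innerJ (D.h (X 0) (X 0)) (D.h (X 1) (X 1)) = 0

variable (hJ : D.Jacobi)

/-- The exterior derivative of the torsion of `𝔤_{f,h,α}`. -/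
noncomputable def torsionDeriv : D.Model hJ [⋀^Fin 4]→ₗ[ℝ] ℝ :=
  extDerivAlternating (torsionAlternating (metric_complexStructure hJ))

theorem torsionDeriv_apply (x y z w : D.Model hJ) :
    torsionDeriv hJ ![x, y, z, w] =
      extDeriv₃ (torsionForm (metric hJ) (complexStructure hJ)) x y z w := rfl

theorem torsionDeriv_ofU_ofJ_ofJ_ofJ (u : V) (y y' y₃ : Fin m → ℂ) :
    torsionDeriv hJ ![ofU hJ u, ofJ hJ y, ofJ hJ y', ofJ hJ y₃] = 0 := by
  simp [torsionDeriv_apply, extDeriv₃, torsionForm_eq (metric_complexStructure hJ)]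

theorem torsionDeriv_ofU_ofU_ofJ_ofJ (u u' : V) (y y' : Fin m → ℂ) :
    torsionDeriv hJ ![ofU hJ u, ofU hJ u', ofJ hJ y, ofJ hJ y'] = 0 := by
  simp [torsionDeriv_apply, extDeriv₃, torsionForm_eq (metric_complexStructure hJ)]

theorem torsionDeriv_ofU_ofR_ofJ_ofJ (u v : V) (y y' : Fin m → ℂ) :
    torsionDeriv hJ ![ofU hJ u, ofR hJ v, ofJ hJ y, ofJ hJ y'] =
      -innerJ (fun i => ((4 * (D.α i u).re * (D.α i v).re + 2 * (D.α i (D.f u v)).re : ℝ) : ℂ)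
        * (Complex.I * y i)) y' := by
  simp only [torsionDeriv_apply, extDeriv₃, lie_ofU_ofR,
    torsionForm_eq (metric_complexStructure hJ), map_add, complexStructure_ofR,
    complexStructure_ofJ, add_lie, lie_ofU_ofJ, Pi.smul_apply, smul_eq_mul, lie_ofJ_ofJ, add_zero,
    metric_ofJ_ofJ, map_zero, LinearMap.zero_apply, lie_add, lie_ofJ_ofU, map_neg,
    LinearMap.neg_apply, neg_add_rev, neg_neg, lie_ofR_ofJ, complexStructure_ofU, lie_neg, zero_lie,
    neg_zero, neg_lie, lie_zero, sub_zero, lie_ofR_ofU, neg_sub, sub_neg_eq_add, Complex.ofReal_add,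
    Complex.ofReal_mul, Complex.ofReal_ofNat]
  simp only [innerJ, ← Finset.sum_neg_distrib, ← Finset.sum_add_distrib, ← Finset.sum_sub_distrib]
  refine Finset.sum_congr rfl fun i _ => ?_
  simp only [Complex.mul_re, Complex.mul_im, Complex.add_re, Complex.add_im, Complex.conj_re,
    Complex.conj_im, Complex.I_re, Complex.I_im, Complex.ofReal_re, Complex.ofReal_im,
    Complex.re_ofNat, Complex.im_ofNat]
  ring

theorem torsionDeriv_ofU_ofR_ofR_ofJ (u v v' : V) (y : Fin m → ℂ) :
    torsionDeriv hJ ![ofU hJ u, ofR hJ v, ofR hJ v', ofJ hJ y] =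
      -innerJ (fun i => Complex.I * (conj (D.α i u) * (D.h v v' i - D.h v' v i)
        + (D.h (D.f u v) v' i - D.h v' (D.f u v) i) + (D.h v (D.f u v') i - D.h (D.f u v') v i)
        - 2 * (D.α i v').re * D.h u v i + 2 * (D.α i v).re * D.h u v' i)) y := by
  simp only [torsionDeriv_apply, extDeriv₃, lie_ofU_ofR,
    torsionForm_eq (metric_complexStructure hJ), map_add, complexStructure_ofR,
    complexStructure_ofJ, add_lie, lie_ofU_ofU, lie_ofJ_ofU, Pi.smul_apply, smul_eq_mul, map_neg,
    LinearMap.add_apply, metric_ofJ_ofJ, LinearMap.neg_apply, lie_ofU_ofJ, metric_ofJ_ofR, zero_add,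
    lie_add, lie_ofJ_ofJ, add_zero, neg_zero, neg_add_rev, neg_neg, lie_ofR_ofR, map_zero,
    complexStructure_ofU, lie_neg, zero_lie, LinearMap.zero_apply, neg_lie, lie_ofR_ofJ, lie_zero,
    sub_zero, lie_ofR_ofU, neg_sub, sub_neg_eq_add]
  simp only [innerJ, ← Finset.sum_neg_distrib, ← Finset.sum_add_distrib, ← Finset.sum_sub_distrib]
  refine Finset.sum_congr rfl fun i _ => ?_
  simp only [Complex.mul_re, Complex.mul_im, Complex.add_re, Complex.add_im, Complex.sub_re,
    Complex.sub_im, Complex.conj_re, Complex.conj_im, Complex.I_re, Complex.I_im, Complex.ofReal_re,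
    Complex.ofReal_im, Complex.re_ofNat, Complex.im_ofNat, Pi.smul_apply, Pi.sub_apply, smul_eq_mul]
  ring

theorem torsionDeriv_ofU_ofU_ofR_ofJ (u u' v : V) (y : Fin m → ℂ) :
    torsionDeriv hJ ![ofU hJ u, ofU hJ u', ofR hJ v, ofJ hJ y] =
      -innerJ (fun i => 2 * (D.α i v).re * (D.h u u' i - D.h u' u i) + conj (D.α i u) * D.h v u' i
        - conj (D.α i u') * D.h v u i + D.h (D.f u v) u' i - D.h (D.f u' v) u i) y := by
  simp only [torsionDeriv_apply, extDeriv₃, lie_ofU_ofU,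
    torsionForm_eq (metric_complexStructure hJ), complexStructure_ofJ, complexStructure_ofR,
    lie_ofJ_ofU, Pi.smul_apply, Pi.sub_apply, smul_eq_mul, map_neg, LinearMap.neg_apply,
    metric_ofJ_ofJ, lie_ofU_ofJ, lie_ofJ_ofJ, map_zero, LinearMap.zero_apply, add_zero, neg_add_rev,
    neg_neg, lie_ofU_ofR, map_add, complexStructure_ofU, lie_neg, add_lie, lie_ofJ_ofR,
    LinearMap.add_apply, metric_ofR_ofJ, neg_zero, neg_lie, lie_ofR_ofJ, lie_add, metric_ofJ_ofU,
    lie_ofR_ofU, neg_sub, sub_neg_eq_add, zero_add, zero_lie, lie_ofR_ofR, lie_zero, sub_zero]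
  simp only [innerJ, ← Finset.sum_neg_distrib, ← Finset.sum_add_distrib, ← Finset.sum_sub_distrib]
  refine Finset.sum_congr rfl fun i _ => ?_
  simp only [Complex.mul_re, Complex.mul_im, Complex.add_re, Complex.add_im, Complex.sub_re,
    Complex.sub_im, Complex.conj_re, Complex.conj_im, Complex.I_re, Complex.I_im, Complex.ofReal_re,
    Complex.ofReal_im, Complex.re_ofNat, Complex.im_ofNat, Pi.smul_apply, Pi.sub_apply, smul_eq_mul]
  ring

theorem torsionDeriv_ofU_ofU_ofR_ofR (u v : V) :
    torsionDeriv hJ ![ofU hJ u, ofU hJ v, ofR hJ u, ofR hJ v] =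
      -(2 * (D.g₀ (D.f u v) (D.f u v) - D.g₀ (D.f u u) (D.f v v))
        + innerJ (D.h u v - D.h v u) (D.h u v - D.h v u)
        + innerJ (D.h u v) (D.h u v) + innerJ (D.h v u) (D.h v u)
        - 2 * innerJ (D.h u u) (D.h v v)) := by
  have h₁ : D.f (D.f u u) v = D.f (D.f u v) u := D.f_f_symm u u v
  have h₂ : D.f (D.f v v) u = D.f (D.f u v) v := by rw [D.f_f_symm, D.f_symm v u]
  simp only [torsionDeriv_apply, extDeriv₃, lie_ofU_ofU,
    torsionForm_eq (metric_complexStructure hJ), complexStructure_ofJ, complexStructure_ofR,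
    lie_ofJ_ofU, Pi.smul_apply, Pi.sub_apply, smul_eq_mul, map_neg, LinearMap.neg_apply,
    metric_ofJ_ofR, neg_zero, metric_ofJ_ofJ, innerJ_I_smul, zero_add, lie_ofU_ofJ, add_zero,
    lie_ofU_ofR, map_add, complexStructure_ofU, lie_neg, add_lie, h₁, lie_ofJ_ofR, neg_add_rev,
    LinearMap.add_apply, metric_ofR_ofR, neg_lie, lie_ofR_ofU, neg_sub, sub_neg_eq_add,
    metric_ofR_ofJ, lie_add, metric_ofJ_ofU, D.f_symm v u, h₂, lie_ofR_ofR, map_zero, zero_lie,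
    LinearMap.zero_apply, lie_zero, sub_zero]
  rw [D.g₀_symm (D.f v v) (D.f u u), innerJ_comm (D.h v v) (D.h u u)]
  ring

theorem PluriclosedEquations.of_torsionDeriv_eq_zero (h : torsionDeriv hJ = 0)
    (X : Module.Basis (Fin 2) ℝ V) : D.PluriclosedEquations X where
  re i u v := by
    have hi := congrFun (eq_zero_of_forall_innerJ_eq_zero fun y' => neg_eq_zero.1 <|
      (torsionDeriv_ofU_ofR_ofJ_ofJ hJ u v (fun _ => 1) y').symm.trans (by rw [h]; rfl)) i
    have hre := (mul_eq_zero.1 hi).resolve_right (by simp)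
    linarith [Complex.ofReal_eq_zero.1 hre]
  mixed i u u' v := congrFun (eq_zero_of_forall_innerJ_eq_zero fun y => neg_eq_zero.1 <|
    (torsionDeriv_ofU_ofU_ofR_ofJ hJ u u' v y).symm.trans (by rw [h]; rfl)) i
  norm := neg_eq_zero.1 <|
    (torsionDeriv_ofU_ofU_ofR_ofR hJ (X 0) (X 1)).symm.trans (by rw [h]; rfl)

theorem range_eq_span_sup_span {W : Type*} [AddCommGroup W] [Module ℝ W] (φ : V →ₗ[ℝ] W)
    (X : Module.Basis (Fin 2) ℝ V) :
    LinearMap.range φ = Submodule.span ℝ {φ (X 1)} ⊔ Submodule.span ℝ {φ (X 0)} := by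
  rw [sup_comm, ← Submodule.span_insert, LinearMap.range_eq_map, ← X.span_eq, Submodule.map_span]
  congr 1
  ext
  simp [Fin.exists_fin_two, eq_comm]

theorem range_ofJ_sup_range_ofR_sup_range_ofU :
    LinearMap.range (ofJ hJ) ⊔ LinearMap.range (ofR hJ) ⊔ LinearMap.range (ofU hJ) = ⊤ := by
  refine eq_top_iff.2 fun x _ => ?_
  rw [eq_ofJ_add_ofR_add_ofU hJ x]
  exact Submodule.add_mem_sup (Submodule.add_mem_sup ⟨_, rfl⟩ ⟨_, rfl⟩) ⟨_, rfl⟩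

theorem lie_eq_zero_of_mem_range_ofJ_sup_range_ofR {x y : D.Model hJ}
    (hx : x ∈ LinearMap.range (ofJ hJ) ⊔ LinearMap.range (ofR hJ))
    (hy : y ∈ LinearMap.range (ofJ hJ) ⊔ LinearMap.range (ofR hJ)) : ⁅x, y⁆ = 0 := by
  obtain ⟨_, ⟨y₁, rfl⟩, _, ⟨v₁, rfl⟩, rfl⟩ := Submodule.mem_sup.1 hx
  obtain ⟨_, ⟨y₂, rfl⟩, _, ⟨v₂, rfl⟩, rfl⟩ := Submodule.mem_sup.1 hy
  simp only [lie_add, add_lie, lie_ofJ_ofJ, lie_ofJ_ofR, lie_ofR_ofJ, lie_ofR_ofR, add_zero]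

namespace PluriclosedEquations

variable {X : Module.Basis (Fin 2) ℝ V} (hD : D.PluriclosedEquations X)
include hD

theorem torsionDeriv_ofU_ofR_ofJ_ofJ (u v : V) (y y' : Fin m → ℂ) :
    torsionDeriv hJ ![ofU hJ u, ofR hJ v, ofJ hJ y, ofJ hJ y'] = 0 := by
  rw [Data.torsionDeriv_ofU_ofR_ofJ_ofJ, neg_eq_zero]
  convert innerJ_zero_left y' using 2
  funext i
  have h : 4 * (D.α i u).re * (D.α i v).re + 2 * (D.α i (D.f u v)).re = 0 := by
    linear_combination 2 * hD.re i u v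
  rw [h, Complex.ofReal_zero, zero_mul, Pi.zero_apply]

theorem torsionDeriv_ofU_ofU_ofR_ofJ (u u' v : V) (y : Fin m → ℂ) :
    torsionDeriv hJ ![ofU hJ u, ofU hJ u', ofR hJ v, ofJ hJ y] = 0 := by
  rw [Data.torsionDeriv_ofU_ofU_ofR_ofJ, neg_eq_zero]
  convert innerJ_zero_left y using 2
  exact funext fun i => hD.mixed i u u' v

theorem torsionDeriv_ofU_ofR_ofR_ofJ (u v v' : V) (y : Fin m → ℂ) :
    torsionDeriv hJ ![ofU hJ u, ofR hJ v, ofR hJ v', ofJ hJ y] = 0 := by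
  rw [Data.torsionDeriv_ofU_ofR_ofR_ofJ, neg_eq_zero]
  convert innerJ_zero_left y using 2
  funext i
  have h₀ := hD.mixed i v v' u
  have h₁ := jacobi_iff.1 hJ i v u v'
  have h₂ := jacobi_iff.1 hJ i v' u v
  rw [D.f_symm v u, D.f_symm v' u] at h₀
  rw [D.f_symm v' v] at h₂
  rw [Pi.zero_apply]
  linear_combination Complex.I * (h₀ + h₁ - h₂
    + D.h u v' i * two_mul_ofReal_re (D.α i v) - D.h u v i * two_mul_ofReal_re (D.α i v')
    - (D.h v v' i - D.h v' v i) * two_mul_ofReal_re (D.α i u))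

theorem vanishesOn_curryLeft_ofU (u : V) :
    VanishesOn ((torsionDeriv hJ).curryLeft (ofU hJ u))
      (LinearMap.range (ofJ hJ) ⊔ Submodule.span ℝ {ofR hJ (X 1)}
        ⊔ Submodule.span ℝ {ofR hJ (X 0)}) := by
  refine (VanishesOn.sup_span_singleton ?_ ?_).sup_span_singleton
    (VanishesOn.sup_span_singleton ?_ ?_)
  all_goals
    repeat'
      refine vanishesOn_of_curryLeft ?_
      rintro _ ⟨_, rfl⟩
    refine vanishesOn_of_apply_empty ?_
  · exact torsionDeriv_ofU_ofJ_ofJ_ofJ hJ u _ _ _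
  · exact hD.torsionDeriv_ofU_ofR_ofJ_ofJ hJ u (X 1) _ _
  · exact hD.torsionDeriv_ofU_ofR_ofJ_ofJ hJ u (X 0) _ _
  · exact hD.torsionDeriv_ofU_ofR_ofR_ofJ hJ u (X 0) (X 1) _

theorem vanishesOn_curryLeft_ofU_curryLeft_ofU :
    VanishesOn (((torsionDeriv hJ).curryLeft (ofU hJ (X 0))).curryLeft (ofU hJ (X 1)))
      (LinearMap.range (ofJ hJ) ⊔ Submodule.span ℝ {ofR hJ (X 1)}
        ⊔ Submodule.span ℝ {ofR hJ (X 0)}) := by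
  refine (VanishesOn.sup_span_singleton ?_ ?_).sup_span_singleton
    (VanishesOn.sup_span_singleton ?_ ?_)
  all_goals
    repeat'
      refine vanishesOn_of_curryLeft ?_
      rintro _ ⟨_, rfl⟩
    refine vanishesOn_of_apply_empty ?_
  · exact torsionDeriv_ofU_ofU_ofJ_ofJ hJ _ _ _ _
  · exact hD.torsionDeriv_ofU_ofU_ofR_ofJ hJ _ _ (X 1) _
  · exact hD.torsionDeriv_ofU_ofU_ofR_ofJ hJ _ _ (X 0) _
  · exact (torsionDeriv_ofU_ofU_ofR_ofR hJ (X 0) (X 1)).trans (neg_eq_zero.2 hD.norm)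

theorem vanishesOn_torsionDeriv : VanishesOn (torsionDeriv hJ) ⊤ := by
  rw [← range_ofJ_sup_range_ofR_sup_range_ofU hJ, range_eq_span_sup_span (ofU hJ) X, ← sup_assoc]
  have hU (u : V) : VanishesOn ((torsionDeriv hJ).curryLeft (ofU hJ u))
      (LinearMap.range (ofJ hJ) ⊔ LinearMap.range (ofR hJ)) := by
    rw [range_eq_span_sup_span (ofR hJ) X, ← sup_assoc]
    exact hD.vanishesOn_curryLeft_ofU hJ u
  have hUU : VanishesOn (((torsionDeriv hJ).curryLeft (ofU hJ (X 0))).curryLeft (ofU hJ (X 1)))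
      (LinearMap.range (ofJ hJ) ⊔ LinearMap.range (ofR hJ)) := by
    rw [range_eq_span_sup_span (ofR hJ) X, ← sup_assoc]
    exact hD.vanishesOn_curryLeft_ofU_curryLeft_ofU hJ
  exact ((vanishesOn_extDerivAlternating_of_lie_eq_zero _ fun x hx y hy =>
    lie_eq_zero_of_mem_range_ofJ_sup_range_ofR hJ hx hy).sup_span_singleton
    (hU _)).sup_span_singleton ((hU _).sup_span_singleton hUU)

end PluriclosedEquations

end Identities
end Data

/-! ### Scalar equations -/

section ScalarEquations

/-- The Jacobi and pluriclosed equations for a single component `h^i`, in a basis `(X₁, X₂)` of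
`𝔞_r` with `f(X₁, X_j) = aX_j` and `f(X₂, X₂) = b₁X₁ + b₂X₂`. Here `z = α_i(X₁)`, `w = α_i(X₂)` and
`p, q, r, s` are the values of `h^i` at `(X₁, X₁)`, `(X₁, X₂)`, `(X₂, X₁)`, `(X₂, X₂)`. -/
structure ComponentEquations (a b₁ b₂ : ℝ) (z w p q r s : ℂ) : Prop where
  jacobi₁ : z * r + a * q = w * p + a * r
  jacobi₂ : z * s + b₁ * p + b₂ * q = w * q + a * s
  re₁ : 2 * z.re * z.re + a * z.re = 0
  re₂ : 2 * z.re * w.re + a * w.re = 0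
  re₃ : 2 * w.re * w.re + (b₁ * z.re + b₂ * w.re) = 0
  mixed₁ : 2 * z.re * (q - r) + conj z * q - conj w * p + a * q - a * r = 0
  mixed₂ : 2 * w.re * (q - r) + conj z * s - conj w * r + a * s - (b₁ * p + b₂ * r) = 0

variable {a b₁ b₂ : ℝ} {z w p q r s : ℂ}

theorem conj_eq_neg_of_re_eq_zero (hz : z.re = 0) : conj z = -z :=
  Complex.ext (by simp [hz]) (by simp)

theorem ofReal_norm_sq (z : ℂ) : (‖z‖ : ℂ) ^ 2 = z * conj z := by
  rw [Complex.mul_conj, Complex.normSq_eq_norm_sq, Complex.ofReal_pow]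

theorem sub_ofReal_ne_zero (hz : z.re ≠ a) : z - a ≠ 0 := fun h =>
  hz (by rw [sub_eq_zero.1 h, Complex.ofReal_re])

theorem ne_zero_of_re_eq_neg_half (ha : a ≠ 0) (hz : z.re = -a / 2) : z ≠ 0 := by
  rintro rfl
  exact ha (by linarith [Complex.zero_re])

theorem ComponentEquations.re_eq_zero_or (h : ComponentEquations a b₁ b₂ z w p q r s) :
    z.re = 0 ∨ z.re = -a / 2 := by
  have h₁ : z.re * (z.re + a / 2) = 0 := by linear_combination h.re₁ / 2
  exact (mul_eq_zero.1 h₁).imp_right fun h₂ => by linarith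

theorem componentEquations_iff_of_re_eq_zero (ha : a ≠ 0) (hz : z.re = 0) :
    ComponentEquations a b₁ b₂ z w p q r s ↔
      w.re = 0 ∧ r = q ∧ z * q = w * p ∧ (z - a) * s = w * q - b₁ * p - b₂ * q := by
  constructor
  · intro h
    have hw : w.re = 0 := (mul_eq_zero.1 (by linear_combination h.re₂ - 2 * w.re * hz :
      a * w.re = 0)).resolve_left ha
    have hza : 2 * (a : ℂ) - z ≠ 0 := fun h' => ha (by simpa [hz] using congrArg Complex.re h')
    have hqr : (2 * a - z) * (q - r) = 0 := by
      have := h.mixed₁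
      rw [hz, conj_eq_neg_of_re_eq_zero hz, conj_eq_neg_of_re_eq_zero hw,
        Complex.ofReal_zero] at this
      linear_combination this + h.jacobi₁
    obtain rfl : q = r := sub_eq_zero.1 ((mul_eq_zero.1 hqr).resolve_left hza)
    exact ⟨hw, rfl, by linear_combination h.jacobi₁, by linear_combination h.jacobi₂⟩
  · rintro ⟨hw, rfl, h₁, h₂⟩
    constructor <;>
      try simp only [hz, hw, conj_eq_neg_of_re_eq_zero hz, conj_eq_neg_of_re_eq_zero hw,
        Complex.ofReal_zero]
    · linear_combination h₁
    · linear_combination h₂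
    · ring
    · ring
    · ring
    · linear_combination -h₁
    · linear_combination -h₂

theorem componentEquations_iff_of_re_eq_neg_half (ha : a ≠ 0) (hz : z.re = -a / 2) :
    ComponentEquations a b₁ b₂ z w p q r s ↔
      2 * w.re ^ 2 + b₂ * w.re - b₁ / 2 * a = 0 ∧ conj z * q = conj w * p ∧
        (z - a) * r = w * p - a * q ∧ (z - a) * s = w * q - b₁ * p - b₂ * q := by
  have hz₂ : (2 * z.re : ℂ) = -a := by
    rw [hz]
    push_cast
    ring
  have hcz : conj z = -a - z := by linear_combination hz₂ - two_mul_ofReal_re z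
  constructor
  · intro h
    refine ⟨by linear_combination h.re₃ - b₁ * hz, ?_, by linear_combination h.jacobi₁,
      by linear_combination h.jacobi₂⟩
    linear_combination h.mixed₁ - (q - r) * hz₂
  · rintro ⟨hw, hq, hr, hs⟩
    have hza : z - a ≠ 0 := sub_ofReal_ne_zero fun h => ha (by linarith)
    have hw₂ : (w + conj w) ^ 2 + b₂ * (w + conj w) - b₁ * a = 0 := by
      rw [← two_mul_ofReal_re]
      exact_mod_cast (by linear_combination 2 * hw :
        (2 * w.re) ^ 2 + b₂ * (2 * w.re) - b₁ * a = 0)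
    refine ⟨by linear_combination hr, by linear_combination hs, ?_, ?_, ?_, ?_, ?_⟩
    · rw [hz]; ring
    · rw [hz]; ring
    · rw [hz]; linear_combination hw
    · linear_combination hq + (q - r) * hz₂
    · refine mul_left_cancel₀ hza ?_
      rw [two_mul_ofReal_re]
      rw [hcz] at hq ⊢
      linear_combination -(w + 2 * conj w + b₂) * hr - z * hs - (conj w + b₂) * hq - p * hw₂

theorem caseI_iff (ha : a ≠ 0) :
    CaseI a b₁ b₂ z w p q r s ↔ z.re = 0 ∧ z ≠ 0 ∧
      w.re = 0 ∧ r = q ∧ z * q = w * p ∧ (z - a) * s = w * q - b₁ * p - b₂ * q := by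
  rw [CaseI]
  constructor
  · rintro ⟨hz, hw, hz₀, rfl, rfl, rfl⟩
    have hza : z - a ≠ 0 := sub_ofReal_ne_zero (hz.trans_ne ha.symm)
    refine ⟨hz, hz₀, hw, rfl, by field_simp, ?_⟩
    field_simp
    ring
  · rintro ⟨hz, hz₀, hw, rfl, h₁, h₂⟩
    have hza : z - a ≠ 0 := sub_ofReal_ne_zero (hz.trans_ne ha.symm)
    refine ⟨hz, hw, hz₀, rfl, ?_, ?_⟩
    · field_simp
      linear_combination h₁
    · field_simp
      linear_combination z * h₂ + (w - b₂) * h₁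

theorem caseII_iff (ha : a ≠ 0) :
    CaseII a b₂ z w p q r s ↔ z = 0 ∧ w ≠ 0 ∧
      w.re = 0 ∧ r = q ∧ z * q = w * p ∧ (z - a) * s = w * q - b₁ * p - b₂ * q := by
  have ha' : (a : ℂ) ≠ 0 := Complex.ofReal_ne_zero.2 ha
  rw [CaseII]
  constructor
  · rintro ⟨rfl, hw, hw₀, rfl, rfl, rfl⟩
    refine ⟨rfl, hw₀, hw, rfl, by ring, ?_⟩
    field_simp
    ring
  · rintro ⟨rfl, hw₀, hw, rfl, h₁, h₂⟩
    obtain rfl : p = 0 :=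
      (mul_eq_zero.1 (h₁.symm.trans (zero_mul _))).resolve_left hw₀
    refine ⟨rfl, hw, hw₀, rfl, rfl, ?_⟩
    field_simp
    linear_combination -h₂

theorem caseIII_iff (ha : a ≠ 0) :
    CaseIII a b₁ b₂ z w p q r s ↔ z.re = -a / 2 ∧
      2 * w.re ^ 2 + b₂ * w.re - b₁ / 2 * a = 0 ∧ conj z * q = conj w * p ∧
        (z - a) * r = w * p - a * q ∧ (z - a) * s = w * q - b₁ * p - b₂ * q := by
  rw [CaseIII]
  refine and_congr_right fun hz => and_congr_right fun _ => ?_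
  have hza : z - a ≠ 0 := sub_ofReal_ne_zero fun h => ha (by linarith)
  have hcz : conj z ≠ 0 := (map_ne_zero _).2 (ne_zero_of_re_eq_neg_half ha hz)
  rw [ofReal_norm_sq, ofReal_norm_sq, show z * conj z - a * conj z = conj z * (z - a) by ring]
  constructor
  · rintro ⟨rfl, rfl, rfl⟩
    refine ⟨by field_simp, ?_, ?_⟩ <;> field_simp
  · rintro ⟨hq, hr, hs⟩
    refine ⟨?_, ?_, ?_⟩ <;> field_simp
    · linear_combination hq
    · linear_combination conj z * hr - a * hq
    · linear_combination conj z * hs + (w - b₂) * hq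

theorem cases_iff (ha : a ≠ 0) :
    CaseI a b₁ b₂ z w p q r s ∨ CaseII a b₂ z w p q r s ∨ CaseIII a b₁ b₂ z w p q r s ↔
      (z ≠ 0 ∨ w ≠ 0) ∧ ComponentEquations a b₁ b₂ z w p q r s := by
  rw [caseI_iff ha, caseII_iff (b₁ := b₁) ha, caseIII_iff ha]
  constructor
  · rintro (⟨hz, hz₀, h⟩ | ⟨hz, hw₀, h⟩ | ⟨hz, h⟩)
    · exact ⟨.inl hz₀, (componentEquations_iff_of_re_eq_zero ha hz).2 h⟩
    · exact ⟨.inr hw₀, (componentEquations_iff_of_re_eq_zero ha (by rw [hz, Complex.zero_re])).2 h⟩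
    · exact ⟨.inl (ne_zero_of_re_eq_neg_half ha hz),
        (componentEquations_iff_of_re_eq_neg_half ha hz).2 h⟩
  · rintro ⟨h₀, h⟩
    rcases h.re_eq_zero_or with hz | hz
    · have h' := (componentEquations_iff_of_re_eq_zero ha hz).1 h
      by_cases hz₀ : z = 0
      · exact .inr (.inl ⟨hz₀, h₀.resolve_left (not_not.2 hz₀), h'⟩)
      · exact .inl ⟨hz, hz₀, h'⟩
    · exact .inr (.inr ⟨hz, (componentEquations_iff_of_re_eq_neg_half ha hz).1 h⟩)

end ScalarEquations

section NormalFrame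

variable {m : ℕ} {V : Type*} [AddCommGroup V] [Module ℝ V] {D : Data m V}
  {X : Module.Basis (Fin 2) ℝ V} {a b₁ b₂ : ℝ}

/-- The part of the normal form of `𝔤_{f,h,α}` which only concerns `f` and `g₀`. -/
structure IsNormalFrame (D : Data m V) (X : Module.Basis (Fin 2) ℝ V) (a b₁ b₂ : ℝ) : Prop where
  orthonormal : ∀ j k, D.g₀ (X j) (X k) = if j = k then 1 else 0
  a_pos : 0 < a
  b₂_nonneg : 0 ≤ b₂
  f_X₁ : ∀ j, D.f (X 0) (X j) = a • X j
  f_X₂ : D.f (X 1) (X 1) = b₁ • X 0 + b₂ • X 1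

theorem exists_coords (X : Module.Basis (Fin 2) ℝ V) (v : V) :
    ∃ s t : ℝ, v = s • X 0 + t • X 1 :=
  ⟨X.repr v 0, X.repr v 1, by rw [← Fin.sum_univ_two fun j => X.repr v j • X j, X.sum_repr]⟩

theorem ne_zero_iff_of_basis_two {W : Type*} [AddCommGroup W] [Module ℝ W]
    (X : Module.Basis (Fin 2) ℝ V) (φ : V →ₗ[ℝ] W) : φ ≠ 0 ↔ φ (X 0) ≠ 0 ∨ φ (X 1) ≠ 0 := by
  rw [← not_and_or, not_iff_not]
  refine ⟨fun h => by simp only [h, LinearMap.zero_apply, and_self], fun h => X.ext fun j => ?_⟩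
  fin_cases j
  exacts [h.1, h.2]

namespace IsNormalFrame

variable (hF : IsNormalFrame D X a b₁ b₂)
include hF

theorem f_X₂_X₁ : D.f (X 1) (X 0) = a • X 1 := by
  rw [D.f_symm, hF.f_X₁]

theorem f_X₁_apply (v : V) : D.f (X 0) v = a • v :=
  LinearMap.congr_fun (X.ext hF.f_X₁ : D.f (X 0) = a • LinearMap.id) v

theorem g₀_f_f : D.g₀ (D.f (X 0) (X 1)) (D.f (X 0) (X 1))
    - D.g₀ (D.f (X 0) (X 0)) (D.f (X 1) (X 1)) = a * (a - b₁) := by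
  simp only [hF.f_X₁, hF.f_X₂, map_add, map_smul, LinearMap.smul_apply, smul_eq_mul,
    hF.orthonormal, if_true, zero_ne_one, if_false]
  ring

theorem componentEquations (hJ : D.Jacobi) (hD : D.PluriclosedEquations X) (i : Fin m) :
    ComponentEquations a b₁ b₂ (D.α i (X 0)) (D.α i (X 1)) (D.h (X 0) (X 0) i)
      (D.h (X 0) (X 1) i) (D.h (X 1) (X 0) i) (D.h (X 1) (X 1) i) := by
  have hjac := Data.jacobi_iff.1 hJ i (X 0) (X 1)
  have hre := hD.re i
  have hmix := hD.mixed i (X 0) (X 1)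
  have hj₁ := hjac (X 0)
  have hj₂ := hjac (X 1)
  have hr₁ := hre (X 0) (X 0)
  have hr₂ := hre (X 0) (X 1)
  have hr₃ := hre (X 1) (X 1)
  have hm₁ := hmix (X 0)
  have hm₂ := hmix (X 1)
  simp only [hF.f_X₁, hF.f_X₂, hF.f_X₂_X₁, map_add, map_smul, LinearMap.add_apply,
    LinearMap.smul_apply, Pi.add_apply, Pi.smul_apply, Complex.real_smul, Complex.add_re,
    Complex.re_ofReal_mul] at hj₁ hj₂ hr₁ hr₂ hr₃ hm₁ hm₂
  exact ⟨hj₁, by linear_combination hj₂, hr₁, hr₂, hr₃, by linear_combination hm₁, hm₂⟩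

section Converse

variable (h : ∀ i, ComponentEquations a b₁ b₂ (D.α i (X 0)) (D.α i (X 1)) (D.h (X 0) (X 0) i)
  (D.h (X 0) (X 1) i) (D.h (X 1) (X 0) i) (D.h (X 1) (X 1) i))
include h

theorem jacobi : D.Jacobi := by
  refine Data.jacobi_iff.2 fun i u u' v => ?_
  obtain ⟨s, t, rfl⟩ := exists_coords X u
  obtain ⟨s', t', rfl⟩ := exists_coords X u'
  obtain ⟨x, y, rfl⟩ := exists_coords X v
  simp only [map_add, map_smul, LinearMap.add_apply, LinearMap.smul_apply, hF.f_X₁, hF.f_X₂,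
    hF.f_X₂_X₁, Pi.add_apply, Pi.smul_apply, Complex.real_smul]
  linear_combination (s * t' - t * s') * (x * (h i).jacobi₁ + y * (h i).jacobi₂)

theorem re (i : Fin m) (u v : V) :
    2 * (D.α i u).re * (D.α i v).re + (D.α i (D.f u v)).re = 0 := by
  obtain ⟨s, t, rfl⟩ := exists_coords X u
  obtain ⟨s', t', rfl⟩ := exists_coords X v
  simp only [map_add, map_smul, LinearMap.add_apply, LinearMap.smul_apply, hF.f_X₁, hF.f_X₂,
    hF.f_X₂_X₁, Complex.real_smul, Complex.add_re, Complex.re_ofReal_mul]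
  linear_combination
    s * s' * (h i).re₁ + (s * t' + t * s') * (h i).re₂ + t * t' * (h i).re₃

theorem mixed (i : Fin m) (u u' v : V) :
    2 * (D.α i v).re * (D.h u u' i - D.h u' u i) + conj (D.α i u) * D.h v u' i
      - conj (D.α i u') * D.h v u i + D.h (D.f u v) u' i - D.h (D.f u' v) u i = 0 := by
  obtain ⟨s, t, rfl⟩ := exists_coords X u
  obtain ⟨s', t', rfl⟩ := exists_coords X u'
  obtain ⟨x, y, rfl⟩ := exists_coords X v
  simp only [map_add, map_smul, LinearMap.add_apply, LinearMap.smul_apply, hF.f_X₁, hF.f_X₂,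
    hF.f_X₂_X₁, Pi.add_apply, Pi.smul_apply, Complex.real_smul, Complex.add_re,
    Complex.re_ofReal_mul, map_mul, Complex.conj_ofReal, Complex.ofReal_add, Complex.ofReal_mul]
  linear_combination (s * t' - t * s') * (x * (h i).mixed₁ + y * (h i).mixed₂)

end Converse

theorem isNormalForm_iff :
    IsNormalForm D X a b₁ b₂ (fun i => D.α i (X 0)) (fun i => D.α i (X 1)) ↔
      D.Jacobi ∧ D.PluriclosedEquations X ∧ ∀ i, D.α i ≠ 0 := by
  simp only [ne_zero_iff_of_basis_two X]
  constructor
  · intro hN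
    have h := fun i => (cases_iff hF.a_pos.ne').1 (hN.cases i)
    refine ⟨hF.jacobi fun i => (h i).2, ⟨hF.re fun i => (h i).2, hF.mixed fun i => (h i).2, ?_⟩,
      fun i => (h i).1⟩
    rw [hF.g₀_f_f]
    linear_combination hN.norm_condition
  · rintro ⟨hJ, hD, hα⟩
    refine { hF with
      α_X₁ := fun _ => rfl
      α_X₂ := fun _ => rfl
      norm_condition := ?_
      cases := fun i => (cases_iff hF.a_pos.ne').2 ⟨hα i, hF.componentEquations hJ hD i⟩ }
    have h := hD.norm
    rw [hF.g₀_f_f] at h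
    linear_combination h

end IsNormalFrame

namespace IsNormalForm

variable {z w : Fin m → ℂ} (hN : IsNormalForm D X a b₁ b₂ z w)
include hN

theorem isNormalFrame : IsNormalFrame D X a b₁ b₂ := { hN with }

theorem jacobi_and_pluriclosedEquations_and_α_ne_zero :
    D.Jacobi ∧ D.PluriclosedEquations X ∧ ∀ i, D.α i ≠ 0 := by
  obtain rfl : (fun i => D.α i (X 0)) = z := funext hN.α_X₁
  obtain rfl : (fun i => D.α i (X 1)) = w := funext hN.α_X₂
  exact hN.isNormalFrame.isNormalForm_iff.1 hN

theorem le_b₁ {i : Fin m} (hi : (z i).re = -a / 2) : b₁ ≥ -b₂ ^ 2 / (4 * a) := by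
  have ha := hN.a_pos
  have h := ((cases_iff ha.ne').1 (hN.cases i)).2.re₃
  rw [hi] at h
  rw [ge_iff_le, div_le_iff₀ (by linarith)]
  nlinarith [sq_nonneg (4 * (w i).re + b₂)]

end IsNormalForm

end NormalFrame

section DerivedAlgebra

variable {L : Type*} [LieRing L] [LieAlgebra ℝ L]

theorem lie_mem_derivedSubspace (x y : L) : ⁅x, y⁆ ∈ derivedSubspace L := by
  change ⁅x, y⁆ ∈ LieAlgebra.derivedSeries ℝ L 1
  rw [LieAlgebra.derivedSeries_def, LieAlgebra.derivedSeriesOfIdeal_succ,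
    LieAlgebra.derivedSeriesOfIdeal_zero]
  exact LieSubmodule.lie_mem_lie (LieSubmodule.mem_top x) (LieSubmodule.mem_top y)

theorem derivedSubspace_le {S : Submodule ℝ L} (h : ∀ x y : L, ⁅x, y⁆ ∈ S) :
    derivedSubspace L ≤ S := by
  rw [derivedSubspace, LieAlgebra.derivedSeries_def, LieAlgebra.derivedSeriesOfIdeal_succ,
    LieAlgebra.derivedSeriesOfIdeal_zero, LieSubmodule.lieIdeal_oper_eq_linear_span',
    Submodule.span_le]
  rintro _ ⟨x, -, y, -, rfl⟩
  exact h x y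

theorem derivedSeries_two_eq_bot_iff :
    LieAlgebra.derivedSeries ℝ L 2 = ⊥ ↔
      ∀ x ∈ derivedSubspace L, ∀ y ∈ derivedSubspace L, ⁅x, y⁆ = 0 := by
  rw [LieAlgebra.derivedSeries_def, LieAlgebra.derivedSeriesOfIdeal_succ,
    LieSubmodule.lie_eq_bot_iff]
  rfl

end DerivedAlgebra

section DerivedAlgebraOfModel

variable {m : ℕ} {V : Type*} [AddCommGroup V] [Module ℝ V] {D : Data m V} (hJ : D.Jacobi)

namespace Data

theorem lie_eq (x y : D.Model hJ) : ⁅x, y⁆ = D.bracket x y := rfl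

/-- The projection of `𝔤_{f,h,α}` to `U_r`. -/
noncomputable def projU : D.Model hJ →ₗ[ℝ] V :=
  (LinearMap.snd ℝ V V ∘ₗ LinearMap.snd ℝ (Fin m → ℂ) (V × V) : Space m V →ₗ[ℝ] V)

theorem projU_surjective : Function.Surjective (D.projU hJ) := fun u => ⟨ofU hJ u, rfl⟩

theorem ker_projU :
    LinearMap.ker (D.projU hJ) = LinearMap.range (ofJ hJ) ⊔ LinearMap.range (ofR hJ) := by
  refine le_antisymm (fun x hx => ?_) (sup_le ?_ ?_)
  · rw [eq_ofJ_add_ofR_add_ofU hJ x, show x.2.2 = 0 from hx, map_zero, add_zero]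
    exact Submodule.add_mem_sup ⟨_, rfl⟩ ⟨_, rfl⟩
  · rintro _ ⟨y, rfl⟩
    rfl
  · rintro _ ⟨v, rfl⟩
    rfl

theorem ofJ_mem_derivedSubspace (hα : ∀ i, D.α i ≠ 0) (y : Fin m → ℂ) :
    ofJ hJ y ∈ derivedSubspace (D.Model hJ) := by
  rw [← Finset.univ_sum_single y, map_sum]
  refine Submodule.sum_mem _ fun i _ => ?_
  obtain ⟨u, hu⟩ : ∃ u, D.α i u ≠ 0 := by
    by_contra! h
    exact hα i (LinearMap.ext h)
  have h : Pi.single i (y i) =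
      fun j => D.α j u * (Pi.single i (y i / D.α i u) : Fin m → ℂ) j := by
    funext j
    rcases eq_or_ne j i with rfl | hj
    · rw [Pi.single_eq_same, Pi.single_eq_same, mul_div_cancel₀ _ hu]
    · rw [Pi.single_eq_of_ne hj, Pi.single_eq_of_ne hj, mul_zero]
  rw [h, ← lie_ofU_ofJ]
  exact lie_mem_derivedSubspace _ _

section Unit

variable {e : V} {a : ℝ} (ha : a ≠ 0) (he : ∀ v, D.f e v = a • v)
include ha he

theorem derivedSubspace_model (hα : ∀ i, D.α i ≠ 0) :
    derivedSubspace (D.Model hJ) = LinearMap.ker (D.projU hJ) := by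
  refine le_antisymm (derivedSubspace_le fun _ _ => rfl) ?_
  rw [ker_projU]
  refine sup_le ?_ ?_
  · rintro _ ⟨y, rfl⟩
    exact ofJ_mem_derivedSubspace hJ hα y
  · rintro _ ⟨v, rfl⟩
    have h := lie_mem_derivedSubspace (ofU hJ e) (ofR hJ v)
    rw [lie_ofU_ofR, he, map_smul] at h
    exact (Submodule.smul_mem_iff _ ha).1
      ((Submodule.add_mem_iff_left _ (ofJ_mem_derivedSubspace hJ hα _)).1 h)

theorem α_ne_zero_of_ofJ_mem_derivedSubspace {i : Fin m}
    (hi : ofJ hJ (Pi.single i 1) ∈ derivedSubspace (D.Model hJ)) : D.α i ≠ 0 := by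
  intro hα
  have hh (u v : V) : a * D.h u v i = D.h e (D.f u v) i := by
    have h := jacobi_iff.1 hJ i u e v
    rw [hα, he, map_smul, Pi.smul_apply, Complex.real_smul] at h
    simpa only [LinearMap.zero_apply, zero_mul, zero_add] using h
  have h_symm (u v : V) : D.h u v i = D.h v u i :=
    mul_left_cancel₀ (Complex.ofReal_ne_zero.2 ha) (by rw [hh, hh, D.f_symm])
  let Λ : D.Model hJ →ₗ[ℝ] ℂ :=
    (a • (LinearMap.proj i ∘ₗ LinearMap.fst ℝ (Fin m → ℂ) (V × V))
      - LinearMap.proj i ∘ₗ D.h e ∘ₗ LinearMap.fst ℝ V V ∘ₗ LinearMap.snd ℝ (Fin m → ℂ) (V × V) :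
        Space m V →ₗ[ℝ] ℂ)
  have hΛ (x : D.Model hJ) : Λ x = a * x.1 i - D.h e x.2.1 i := rfl
  have hle : derivedSubspace (D.Model hJ) ≤ LinearMap.ker Λ := derivedSubspace_le fun x y => by
    rw [LinearMap.mem_ker, hΛ]
    simp only [lie_eq, bracket, hα, h₂, LinearMap.zero_apply, Pi.smul_apply, Pi.sub_apply,
      h_symm x.2.2 y.2.2, map_sub, ← hh, smul_eq_mul]
    ring
  have h₀ : Λ (ofJ hJ (Pi.single i 1)) = a := by
    change a * (Pi.single i 1 : Fin m → ℂ) i - D.h e 0 i = a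
    rw [Pi.single_eq_same, map_zero, Pi.zero_apply, mul_one, sub_zero]
  exact ha (Complex.ofReal_eq_zero.1 (h₀.symm.trans (hle hi)))

end Unit

theorem finrank_model (X : Module.Basis (Fin 2) ℝ V) :
    Module.finrank ℝ (D.Model hJ) = 2 * (m + 2) := by
  have := Module.Finite.of_basis X
  have hV : Module.finrank ℝ V = 2 := by rw [Module.finrank_eq_card_basis X, Fintype.card_fin]
  change Module.finrank ℝ ((Fin m → ℂ) × V × V) = _
  rw [Module.finrank_prod, Module.finrank_prod, hV, Module.finrank_pi_fintype]
  simp only [Complex.finrank_real_complex, Finset.sum_const, Finset.card_univ, Fintype.card_fin,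
    smul_eq_mul]
  ring

end Data

theorem IsNormalForm.exists_isTwoStepSKTNonComplexCodimTwo {X : Module.Basis (Fin 2) ℝ V}
    {a b₁ b₂ : ℝ} {z w : Fin m → ℂ} (hN : IsNormalForm D X a b₁ b₂ z w) :
    ∃ hJ : D.Jacobi,
      IsTwoStepSKTNonComplexCodimTwo (Data.metric hJ) (Data.complexStructure hJ) := by
  obtain ⟨hJ, hD, hα⟩ := hN.jacobi_and_pluriclosedEquations_and_α_ne_zero
  have hder := Data.derivedSubspace_model hJ hN.a_pos.ne' hN.isNormalFrame.f_X₁_apply hα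
  refine ⟨hJ, {
    skt := { Data.isHermitian hJ with torsion_closed := ?_ }
    two_step := ?_
    non_complex := ?_
    codim_two := ?_ }⟩
  · exact extDeriv₃_torsionForm_eq_zero_of_vanishesOn_top _ (hD.vanishesOn_torsionDeriv hJ)
  · rw [derivedSeries_two_eq_bot_iff, hder, Data.ker_projU]
    exact fun x hx y hy => Data.lie_eq_zero_of_mem_range_ofJ_sup_range_ofR hJ hx hy
  · rw [hder, IsComplexSubspace, inf_eq_left]
    intro h
    obtain ⟨x, hx, hx'⟩ := h (show Data.ofR hJ (X 0) ∈ _ from rfl)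
    have h₁ : -x.2.2 = X 0 := congrArg (fun p : Space m V => p.2.1) hx'
    have h₂ : x.2.2 = 0 := hx
    exact X.ne_zero 0 (by rw [← h₁, h₂, neg_zero])
  · rw [hder, ((D.projU hJ).quotKerEquivOfSurjective (Data.projU_surjective hJ)).finrank_eq,
      Module.finrank_eq_card_basis X, Fintype.card_fin]

end DerivedAlgebraOfModel

/-! ### Simultaneous diagonalization -/

section NormalOperators

variable {E : Type*} [NormedAddCommGroup E] [InnerProductSpace ℂ E] [FiniteDimensional ℂ E]

theorem eq_zero_of_trace_star_mul_self_eq_zero {A : E →ₗ[ℂ] E}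
    (h : LinearMap.trace ℂ E (star A * A) = 0) : A = 0 := by
  let b := stdOrthonormalBasis ℂ E
  have htrace : LinearMap.trace ℂ E (star A * A) = ((∑ i, ‖A (b i)‖ ^ 2 : ℝ) : ℂ) := by
    rw [LinearMap.trace_eq_sum_inner _ b]
    push_cast
    refine Finset.sum_congr rfl fun i _ => ?_
    rw [Module.End.mul_apply, LinearMap.star_eq_adjoint, LinearMap.adjoint_inner_right,
      inner_self_eq_norm_sq_to_K]
    rfl
  rw [htrace, Complex.ofReal_eq_zero,
    Finset.sum_eq_zero_iff_of_nonneg fun i _ => sq_nonneg _] at h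
  refine b.toBasis.ext fun i => ?_
  simpa using h i (Finset.mem_univ i)

-- With `C = [A*, A]` and `S = A + A*` one has `C = S A - A S`, so if `C` commutes with `S` then
-- `tr (C²) = tr (C S A) - tr (C A S) = tr (S C A) - tr (C A S) = 0`.
theorem isStarNormal_of_commute {A : E →ₗ[ℂ] E}
    (h : Commute (star A * A - A * star A) (A + star A)) : IsStarNormal A := by
  set C := star A * A - A * star A with hC
  have hstar : star C = C := by simp only [hC, star_sub, star_mul, star_star]
  have hcomm : C = (A + star A) * A - A * (A + star A) := by rw [hC]; noncomm_ring
  refine ⟨sub_eq_zero.mp (eq_zero_of_trace_star_mul_self_eq_zero ?_)⟩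
  calc LinearMap.trace ℂ E (star C * C)
      = LinearMap.trace ℂ E (C * (A + star A) * A) -
          LinearMap.trace ℂ E (C * A * (A + star A)) := by
        rw [hstar, ← map_sub, mul_assoc, mul_assoc, ← mul_sub, ← hcomm]
    _ = 0 := by rw [h.eq, LinearMap.trace_mul_comm ℂ (C * A), ← mul_assoc, sub_self]

theorem commute_star_left {A B : E →ₗ[ℂ] E} (hA : IsStarNormal A) (h : Commute A B) :
    Commute (star A) B := by
  let toCLM : (E →ₗ[ℂ] E) ≃ₐ[ℂ] (E →L[ℂ] E) := Module.End.toContinuousLinearMap E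
  have hstar : ∀ T, toCLM (star T) = star (toCLM T) := LinearMap.adjoint_toContinuousLinearMap
  have hA' : IsStarNormal (toCLM A) := ⟨by
    rw [← hstar]
    exact hA.star_comm_self.map toCLM⟩
  have hcomm := hA'.commute_star_left (h.map toCLM)
  rw [← hstar] at hcomm
  exact hcomm.of_map toCLM.injective

theorem isStarNormal_of_relations {A B : E →ₗ[ℂ] E} (hAB : Commute A B) {a b₁ b₂ : ℂ}
    (hA : (A + star A) * A + star A * (A + star A) + a • (A + star A) = 0)
    (hB : (B + star B) * B + star B * (B + star B) + b₁ • (A + star A) + b₂ • (B + star B) = 0) :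
    IsStarNormal A ∧ IsStarNormal B := by
  have selfCommutator : ∀ T : E →ₗ[ℂ] E, star T * T - T * star T =
      (T + star T) * T + star T * (T + star T) - (T + star T) * (T + star T) := fun T => by
    noncomm_ring
  have nA : IsStarNormal A := by
    refine isStarNormal_of_commute ?_
    rw [selfCommutator, eq_neg_of_add_eq_zero_left hA]
    exact (((Commute.refl _).smul_left a).neg_left).sub_left ((Commute.refl _).mul_left (.refl _))
  refine ⟨nA, isStarNormal_of_commute ?_⟩
  have hAB' : Commute (star A) B := commute_star_left nA hAB
  have hBA' : Commute A (star B) := by simpa only [star_star] using hAB'.star_star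
  have hre : Commute (A + star A) (B + star B) :=
    (hAB.add_left hAB').add_right (hBA'.add_left hAB.star_star)
  have hB' : (B + star B) * B + star B * (B + star B) =
      -(b₁ • (A + star A) + b₂ • (B + star B)) := by
    rw [eq_neg_iff_add_eq_zero, ← hB]; abel
  rw [selfCommutator, hB']
  exact (((hre.smul_left b₁).add_left ((Commute.refl _).smul_left b₂)).neg_left).sub_left
    ((Commute.refl _).mul_left (.refl _))

theorem exists_orthonormalBasis_of_isSymmetric {ι : Type*} {T : ι → E →ₗ[ℂ] E}
    (hT : ∀ i, (T i).IsSymmetric) (hcomm : ∀ i j, Commute (T i) (T j)) :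
    ∃ (b : OrthonormalBasis (Fin (Module.finrank ℂ E)) ℂ E) (c : Fin _ → ι → ℂ),
      ∀ i k, T i (b k) = c k i • b k := by
  classical
  have hsum := DirectSum.isInternal_ne_bot_iff.mpr
    (LinearMap.IsSymmetric.directSum_isInternal_of_pairwise_commute hT fun i j _ => hcomm i j)
  have horth := (LinearMap.IsSymmetric.orthogonalFamily_iInf_eigenspaces hT).comp
    (Subtype.val_injective (p := fun χ : ι → ℂ =>
      ⨅ j, Module.End.eigenspace (T j) (χ j) ≠ ⊥))
  have : Finite {χ : ι → ℂ // ⨅ j, Module.End.eigenspace (T j) (χ j) ≠ ⊥} :=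
    (WellFoundedGT.finite_ne_bot_of_iSupIndep
      (LinearMap.IsSymmetric.orthogonalFamily_iInf_eigenspaces hT).independent).to_subtype
  have := Fintype.ofFinite {χ : ι → ℂ // ⨅ j, Module.End.eigenspace (T j) (χ j) ≠ ⊥}
  refine ⟨hsum.subordinateOrthonormalBasis rfl horth,
    fun k => (hsum.subordinateOrthonormalBasisIndex rfl k horth).1, fun i k => ?_⟩
  have hk := hsum.subordinateOrthonormalBasis_subordinate rfl k horth
  exact Module.End.mem_eigenspace_iff.mp ((Submodule.mem_iInf _).mp hk i)

open scoped ComplexStarModule in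
theorem exists_orthonormalBasis_of_isStarNormal {ι : Type*} {T : ι → E →ₗ[ℂ] E}
    (hT : ∀ i, IsStarNormal (T i)) (hcomm : ∀ i j, Commute (T i) (T j)) :
    ∃ (b : OrthonormalBasis (Fin (Module.finrank ℂ E)) ℂ E) (c : Fin _ → ι → ℂ),
      ∀ i k, T i (b k) = c k i • b k := by
  have hcomm' : ∀ i j, Commute (star (T i)) (T j) := fun i j => commute_star_left (hT i) (hcomm i j)
  have commute_parts : ∀ {A B : E →ₗ[ℂ] E}, Commute A B → Commute (star A) B →
      Commute (ℜ A : E →ₗ[ℂ] E) B ∧ Commute (ℑ A : E →ₗ[ℂ] E) B := fun h h' => by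
    rw [realPart_apply_coe, imaginaryPart_apply_coe]
    exact ⟨(h.add_left h').smul_left _, ((h.sub_left h').smul_left _).smul_left _⟩
  have hparts : ∀ i j, Commute (ℜ (T i) : E →ₗ[ℂ] E) (T j) ∧ Commute (ℑ (T i) : E →ₗ[ℂ] E) (T j) :=
    fun i j => commute_parts (hcomm i j) (hcomm' i j)
  have hstar : ∀ {A B : E →ₗ[ℂ] E}, IsSelfAdjoint A → Commute A B → Commute (star B) A :=
    fun hA h => by simpa only [hA.star_eq] using h.symm.star_star
  obtain ⟨b, c, hc⟩ := exists_orthonormalBasis_of_isSymmetric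
    (T := Sum.elim (fun i => (ℜ (T i) : E →ₗ[ℂ] E)) fun i => (ℑ (T i) : E →ₗ[ℂ] E))
    (by
      rintro (i | i) <;> rw [LinearMap.isSymmetric_iff_isSelfAdjoint]
      · exact (ℜ (T i)).2
      · exact (ℑ (T i)).2)
    (by
      have hre i j := commute_parts (hparts j i).1.symm (hstar (ℜ (T j)).2 (hparts j i).1)
      have him i j := commute_parts (hparts j i).2.symm (hstar (ℑ (T j)).2 (hparts j i).2)
      rintro (i | i) (j | j)
      exacts [(hre i j).1, (him i j).1, (hre i j).2, (him i j).2])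
  refine ⟨b, fun k i => c k (.inl i) + Complex.I * c k (.inr i), fun i k => ?_⟩
  conv_lhs => rw [← realPart_add_I_smul_imaginaryPart (T i)]
  rw [LinearMap.add_apply, LinearMap.smul_apply, add_smul, mul_smul]
  exact congrArg₂ _ (hc (.inl i) k) (congrArg _ (hc (.inr i) k))

end NormalOperators

section Eigenbasis

theorem repr_apply_of_eigenbasis {ι R M : Type*} [CommSemiring R] [AddCommMonoid M] [Module R M]
    (b : Module.Basis ι R M) {T : M →ₗ[R] M} {c : ι → R} (hc : ∀ i, T (b i) = c i • b i) (x : M)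
    (i : ι) : b.repr (T x) i = c i * b.repr x i := by
  have hcoord : b.coord i ∘ₗ T = c i • b.coord i := b.ext fun j => by
    rcases eq_or_ne j i with rfl | hj
    · simp [hc]
    · simp [hc, Finsupp.single_eq_of_ne hj.symm]
  exact LinearMap.congr_fun hcoord x

variable {E : Type*} [NormedAddCommGroup E] [InnerProductSpace ℂ E]

theorem eq_zero_of_re_inner {T : E →ₗ[ℂ] E} (hT : ∀ x y, (inner ℂ (T x) y).re = 0) : T = 0 :=
  LinearMap.ext fun x => inner_self_eq_zero.mp
    (Complex.ext (hT x (T x)) (inner_self_im (𝕜 := ℂ) (T x)))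

variable [FiniteDimensional ℂ E]

theorem exists_orthonormalBasis_of_relations {A B : E →ₗ[ℂ] E} (hAB : Commute A B) {a b₁ b₂ : ℝ}
    (hA : ∀ x y, (inner ℂ (A (A x)) y + 2 * inner ℂ (A x) (A y) + inner ℂ x (A (A y))
      + a * (inner ℂ (A x) y + inner ℂ x (A y))).re = 0)
    (hB : ∀ x y, (inner ℂ (B (B x)) y + 2 * inner ℂ (B x) (B y) + inner ℂ x (B (B y))
      + b₁ * (inner ℂ (A x) y + inner ℂ x (A y))
      + b₂ * (inner ℂ (B x) y + inner ℂ x (B y))).re = 0) :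
    ∃ (b : OrthonormalBasis (Fin (Module.finrank ℂ E)) ℂ E) (z w : Fin _ → ℂ),
      (∀ k, A (b k) = z k • b k) ∧ ∀ k, B (b k) = w k • b k := by
  have inner_star : ∀ (T : E →ₗ[ℂ] E) x y, inner ℂ ((star T) x) y = inner ℂ x (T y) :=
    fun T x y => by rw [LinearMap.star_eq_adjoint, LinearMap.adjoint_inner_left]
  obtain ⟨nA, nB⟩ := isStarNormal_of_relations (a := a) (b₁ := b₁) (b₂ := b₂) hAB
    (eq_zero_of_re_inner fun x y => by
      rw [← hA x y]
      simp only [LinearMap.add_apply, Module.End.mul_apply, LinearMap.smul_apply, inner_add_left,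
        inner_smul_left, inner_star, map_add, Complex.conj_ofReal]
      ring_nf)
    (eq_zero_of_re_inner fun x y => by
      rw [← hB x y]
      simp only [LinearMap.add_apply, Module.End.mul_apply, LinearMap.smul_apply, inner_add_left,
        inner_smul_left, inner_star, map_add, Complex.conj_ofReal]
      ring_nf)
  obtain ⟨b, c, hc⟩ := exists_orthonormalBasis_of_isStarNormal (T := ![A, B])
    (Fin.forall_fin_two.mpr ⟨nA, nB⟩)
    (Fin.forall_fin_two.mpr ⟨Fin.forall_fin_two.mpr ⟨.refl A, hAB⟩,
      Fin.forall_fin_two.mpr ⟨hAB.symm, .refl B⟩⟩)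
  exact ⟨b, fun k => c k 0, fun k => c k 1, hc 0, hc 1⟩

end Eigenbasis

section HermitianForms

variable {H : Type*} [AddCommGroup H] [Module ℝ H]

/-- A Hermitian structure on a real vector space: a Euclidean metric together with an orthogonal
complex structure. -/
structure IsHermitianForm (g : LinearMap.BilinForm ℝ H) (J : H →ₗ[ℝ] H) : Prop where
  symm : ∀ x y, g x y = g y x
  pos : ∀ x, x ≠ 0 → 0 < g x x
  sq : ∀ x, J (J x) = -x
  orthogonal : ∀ x y, g (J x) (J y) = g x y

namespace IsHermitianForm

variable {g : LinearMap.BilinForm ℝ H} {J : H →ₗ[ℝ] H}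

/-- The complex vector space structure in which `J` is multiplication by `i`. -/
abbrev complexModule (h : IsHermitianForm g J) : Module ℂ H :=
  Module.compHom H (Complex.lift ⟨J, LinearMap.ext h.sq⟩).toRingHom

theorem complex_smul (h : IsHermitianForm g J) (c : ℂ) (x : H) :
    letI := h.complexModule
    c • x = c.re • x + c.im • J x := by
  change Complex.lift ⟨J, LinearMap.ext h.sq⟩ c x = _
  simp [Complex.lift, Complex.liftAux_apply]

theorem I_smul (h : IsHermitianForm g J) (x : H) :
    letI := h.complexModule
    Complex.I • x = J x := by
  rw [h.complex_smul, Complex.I_re, Complex.I_im, zero_smul, zero_add, one_smul]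

theorem isScalarTower (h : IsHermitianForm g J) :
    letI := h.complexModule
    IsScalarTower ℝ ℂ H :=
  letI := h.complexModule
  ⟨fun r c x => by
    rw [h.complex_smul, h.complex_smul, Complex.smul_re, Complex.smul_im, smul_add, smul_assoc,
      smul_assoc]⟩

theorem even_finrank (h : IsHermitianForm g J) : Even (Module.finrank ℝ H) := by
  let := h.complexModule
  have := h.isScalarTower
  rw [← Module.finrank_mul_finrank ℝ ℂ H, Complex.finrank_real_complex]
  exact even_two_mul _

theorem apply_J (h : IsHermitianForm g J) (x y : H) : g x (J y) = -g (J x) y := by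
  rw [← h.orthogonal x, h.sq, map_neg]

/-- The Hermitian inner product `g(x, y) + i g(Jx, y)`, which is conjugate linear in `x`. -/
abbrev core (h : IsHermitianForm g J) :
    letI := h.complexModule
    InnerProductSpace.Core ℂ H :=
  letI := h.complexModule
  { inner := fun x y => ⟨g x y, g (J x) y⟩
    conj_inner_symm := fun x y => Complex.ext (h.symm y x) (by
      change -g (J y) x = g (J x) y
      rw [← h.apply_J, h.symm])
    re_inner_nonneg := fun x => by
      rcases eq_or_ne x 0 with rfl | hx
      · exact (map_zero (g 0)).ge
      · exact (h.pos x hx).le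
    add_left := fun x y z => Complex.ext (by simp) (by simp)
    smul_left := fun x y c => Complex.ext (by simp [h.complex_smul])
      (by simp [h.complex_smul, h.sq])
    definite := fun x hx => by
      by_contra hne
      exact (h.pos x hne).ne' (congrArg Complex.re hx) }

variable [Module.Finite ℝ H]

theorem exists_diagonalizing_coordinates (h : IsHermitianForm g J) {A B : H →ₗ[ℝ] H}
    (hA : ∀ x, A (J x) = J (A x)) (hB : ∀ x, B (J x) = J (B x)) (hAB : Commute A B)
    {a b₁ b₂ : ℝ}
    (h₁ : ∀ x y, g (A (A x)) y + 2 * g (A x) (A y) + g x (A (A y))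
      + a * (g (A x) y + g x (A y)) = 0)
    (h₂ : ∀ x y, g (B (B x)) y + 2 * g (B x) (B y) + g x (B (B y))
      + b₁ * (g (A x) y + g x (A y)) + b₂ * (g (B x) y + g x (B y)) = 0) :
    ∃ (m : ℕ) (φ : H ≃ₗ[ℝ] (Fin m → ℂ)) (z w : Fin m → ℂ), (∀ x, φ (J x) = Complex.I • φ x) ∧
      (∀ x y, g x y = Data.innerJ (φ x) (φ y)) ∧ (∀ x i, φ (A x) i = z i * φ x i) ∧
      ∀ x i, φ (B x) i = w i * φ x i := by
  let : Module ℂ H := h.complexModule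
  let : NormedAddCommGroup H := h.core.toNormedAddCommGroup
  let : InnerProductSpace ℂ H := InnerProductSpace.ofCore h.core.toCore
  have : IsScalarTower ℝ ℂ H := h.isScalarTower
  have : Module.Finite ℂ H := Module.Finite.of_restrictScalars_finite ℝ ℂ H
  have re_inner : ∀ x y, (inner ℂ x y).re = g x y := fun x y => rfl
  let complexify (T : H →ₗ[ℝ] H) (hT : ∀ x, T (J x) = J (T x)) : H →ₗ[ℂ] H :=
    { toFun := T
      map_add' := T.map_add
      map_smul' := fun c x => by
        simp only [h.complex_smul, map_add, map_smul, hT, RingHom.id_apply] }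
  have complexify_apply : ∀ T hT x, complexify T hT x = T x := fun T hT x => rfl
  obtain ⟨b, z, w, hz, hw⟩ := exists_orthonormalBasis_of_relations (A := complexify A hA)
    (B := complexify B hB) (LinearMap.ext fun x => LinearMap.congr_fun hAB x)
    (a := a) (b₁ := b₁) (b₂ := b₂)
    (fun x y => by
      simpa only [Complex.add_re, Complex.re_ofReal_mul, re_inner, complexify_apply, two_mul]
        using h₁ x y)
    (fun x y => by
      simpa only [Complex.add_re, Complex.re_ofReal_mul, re_inner, complexify_apply, two_mul]
        using h₂ x y)
  refine ⟨_, b.toBasis.equivFun.restrictScalars ℝ, z, w, fun x => ?_, fun x y => ?_,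
    repr_apply_of_eigenbasis b.toBasis (T := complexify A hA) (by simpa using hz),
    repr_apply_of_eigenbasis b.toBasis (T := complexify B hB) (by simpa using hw)⟩
  · rw [← h.I_smul]
    exact map_smul b.toBasis.equivFun _ _
  · rw [← re_inner, ← b.repr.inner_map_map, PiLp.inner_apply, Complex.re_sum]
    exact Finset.sum_congr rfl fun i _ => congrArg Complex.re (mul_comm _ _)

end IsHermitianForm

end HermitianForms

section Unit

theorem exists_forall_mul_eq_self {R A : Type*} [CommRing R] [NonUnitalCommRing A] [Module R A]
    [IsScalarTower R A A] [SMulCommClass R A A] [Module.Finite R A]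
    (h : Submodule.span R {z : A | ∃ x y, x * y = z} = ⊤) : ∃ e : A, ∀ x, e * x = x := by
  let I : Ideal (Unitization R A) := RingHom.ker (Unitization.fstHom R A)
  have inr_mem : ∀ x : A, (x : Unitization R A) ∈ I := Unitization.fst_inr R
  have exists_inr : ∀ {p}, p ∈ I → ∃ x : A, (x : Unitization R A) = p := fun {p} hp =>
    ⟨p.snd, Unitization.ext (show p.fst = 0 from hp).symm rfl⟩
  have hfg : I.FG := by
    refine Submodule.FG.of_restrictScalars R ?_
    have hI : I.restrictScalars R = Submodule.map (Unitization.inrHom R R A) ⊤ := by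
      ext p
      refine ⟨fun hp => ?_, ?_⟩
      · obtain ⟨x, rfl⟩ := exists_inr hp
        exact ⟨x, Submodule.mem_top, rfl⟩
      · rintro ⟨x, -, rfl⟩
        exact inr_mem x
    rw [hI]
    exact Module.Finite.fg_top.map _
  have hidem : IsIdempotentElem I := by
    refine le_antisymm Ideal.mul_le_left fun p hp => ?_
    obtain ⟨x, rfl⟩ := exists_inr hp
    have hx : x ∈ Submodule.span R {z : A | ∃ x y, x * y = z} := h ▸ Submodule.mem_top
    induction hx using Submodule.span_induction with
    | mem _ hz =>
      obtain ⟨x, y, rfl⟩ := hz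
      rw [Unitization.inr_mul]
      exact Ideal.mul_mem_mul (inr_mem x) (inr_mem y)
    | zero => exact zero_mem _
    | add x y _ _ hx hy =>
      rw [Unitization.inr_add]
      exact add_mem (hx (inr_mem _)) (hy (inr_mem _))
    | smul c x _ hx =>
      rw [Unitization.inr_smul]
      exact Submodule.smul_of_tower_mem _ c (hx (inr_mem _))
  obtain ⟨e, he, hI⟩ := (Ideal.isIdempotentElem_iff_of_fg I hfg).mp hidem
  obtain ⟨e, rfl⟩ := exists_inr (hI.symm ▸ Ideal.mem_span_singleton_self e : e ∈ I)
  refine ⟨e, fun x => Unitization.inr_injective (R := R) ?_⟩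
  obtain ⟨r, hr⟩ := Ideal.mem_span_singleton.mp (hI ▸ inr_mem x)
  rw [Unitization.inr_mul, hr, ← mul_assoc, he.eq]

end Unit

section OrthonormalBases

variable {V : Type*} [AddCommGroup V] [Module ℝ V] {g : LinearMap.BilinForm ℝ V}
  (symm : ∀ x y, g x y = g y x) (pos : ∀ x, x ≠ 0 → 0 < g x x)
include symm pos

theorem exists_orthonormal_basis_smul_eq {n : ℕ} (hn : Module.finrank ℝ V = n + 1) {e : V}
    (he : e ≠ 0) :
    ∃ X : Module.Basis (Fin (n + 1)) ℝ V, (∀ j k, g (X j) (X k) = if j = k then 1 else 0) ∧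
      ∃ a > 0, X 0 = (a : ℝ) • e := by
  let core : InnerProductSpace.Core ℝ V :=
    { inner := fun x y => g x y
      conj_inner_symm := fun x y => symm y x
      re_inner_nonneg := fun x => by
        rcases eq_or_ne x 0 with rfl | hx
        · exact (map_zero (g 0)).ge
        · exact (pos x hx).le
      add_left := fun x y z => by rw [map_add, LinearMap.add_apply]
      smul_left := fun x y t => by rw [map_smul, LinearMap.smul_apply]; rfl
      definite := fun x hx => by
        by_contra hne
        exact (pos x hne).ne' hx }
  let : NormedAddCommGroup V := core.toNormedAddCommGroup
  let : InnerProductSpace ℝ V := InnerProductSpace.ofCore core.toCore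
  have : Module.Finite ℝ V := Module.finite_of_finrank_eq_succ hn
  have he₁ : ‖‖e‖⁻¹ • e‖ = 1 := norm_smul_inv_norm (𝕜 := ℝ) he
  obtain ⟨b, hb⟩ := Orthonormal.exists_orthonormalBasis_extension_of_card_eq (𝕜 := ℝ)
    (ι := Fin (n + 1)) (v := fun _ => ‖e‖⁻¹ • e) (s := {0}) (by rw [hn, Fintype.card_fin])
    ⟨fun _ => he₁, fun j k hjk => absurd (Subsingleton.elim j k) hjk⟩
  refine ⟨b.toBasis, fun j k => ?_, ‖e‖⁻¹, inv_pos.2 (norm_pos_iff.2 he), ?_⟩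
  · rw [b.coe_toBasis]
    exact orthonormal_iff_ite.1 b.orthonormal j k
  · rw [b.coe_toBasis]
    exact hb 0 rfl

theorem exists_normal_basis (hV : Module.finrank ℝ V = 2) {f : V →ₗ[ℝ] V →ₗ[ℝ] V} {e : V}
    (he : ∀ x, f e x = x) :
    ∃ (X : Module.Basis (Fin 2) ℝ V) (a b₁ b₂ : ℝ),
      (∀ j k, g (X j) (X k) = if j = k then 1 else 0) ∧ 0 < a ∧ 0 ≤ b₂ ∧
      (∀ x, f (X 0) x = a • x) ∧ f (X 1) (X 1) = b₁ • X 0 + b₂ • X 1 := by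
  have he₀ : e ≠ 0 := by
    rintro rfl
    have : Nontrivial V := Module.nontrivial_of_finrank_pos (R := ℝ) (hV ▸ two_pos)
    obtain ⟨x, hx⟩ := exists_ne (0 : V)
    exact hx (by rw [← he x, map_zero, LinearMap.zero_apply])
  obtain ⟨X : Module.Basis (Fin 2) ℝ V, hX, a, ha, hXe⟩ :=
    exists_orthonormal_basis_smul_eq symm pos hV he₀
  have h₀ (x : V) : f (X 0) x = a • x := by rw [hXe, map_smul, LinearMap.smul_apply, he]
  obtain ⟨b₁, b₂, h₁⟩ := exists_coords X (f (X 1) (X 1))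
  rcases le_total 0 b₂ with hb₂ | hb₂
  · exact ⟨X, a, b₁, b₂, hX, ha, hb₂, h₀, h₁⟩
  · let X' := X.unitsSMul ![1, -1]
    have hX'₀ : X' 0 = X 0 := (X.unitsSMul_apply 0).trans (one_smul _ _)
    have hX'₁ : X' 1 = -X 1 := (X.unitsSMul_apply 1).trans (neg_one_smul _ _)
    refine ⟨X', a, b₁, -b₂, fun j k => ?_, ha, neg_nonneg.2 hb₂, by rwa [hX'₀], ?_⟩
    · fin_cases j <;> fin_cases k <;> simp [hX'₀, hX'₁, hX]
    · simp only [hX'₀, hX'₁, map_neg, LinearMap.neg_apply, neg_neg, h₁, neg_smul, smul_neg]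

end OrthonormalBases

/-! ### Structure of two-step Lie algebras -/

section ComplexCore

variable {L : Type*} [LieRing L] [LieAlgebra ℝ L]

/-- The maximal complex subspace `𝔞_J = 𝔤' ∩ J𝔤'` of the derived algebra. -/
def complexCore (J : L →ₗ[ℝ] L) : Submodule ℝ L :=
  derivedSubspace L ⊓ (derivedSubspace L).comap J

/-- The orthogonal complement `𝔞_r` of the maximal complex subspace in the derived algebra. -/
def realPart (g : LinearMap.BilinForm ℝ L) (J : L →ₗ[ℝ] L) : Submodule ℝ L :=
  derivedSubspace L ⊓ g.orthogonal (complexCore J)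

variable {g : LinearMap.BilinForm ℝ L} {J : L →ₗ[ℝ] L}

theorem IsHermitianForm.restrict (h : IsHermitianForm g J) {W : Submodule ℝ L}
    (hW : ∀ x ∈ W, J x ∈ W) : IsHermitianForm (g.restrict W) (J.restrict hW) where
  symm x y := h.symm x y
  pos x hx := h.pos x (Subtype.coe_ne_coe.2 hx)
  sq x := Subtype.ext (h.sq x)
  orthogonal x y := h.orthogonal x y

namespace IsHermitian

variable (h : IsHermitian g J)
include h

theorem isHermitianForm : IsHermitianForm g J := { h with }

theorem J_mem_complexCore {x : L} (hx : x ∈ complexCore J) : J x ∈ complexCore J :=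
  ⟨hx.2, show J (J x) ∈ derivedSubspace L by rw [h.sq]; exact neg_mem hx.1⟩

theorem eq_zero_of_mem {x : L} (hx : x ∈ complexCore J) (hx' : x ∈ realPart g J) : x = 0 := by
  by_contra hne
  exact (h.pos x hne).ne' (hx'.2 x hx)

theorem comap_eq_map (W : Submodule ℝ L) : W.comap J = W.map J := by
  ext x
  constructor
  · exact fun hx => ⟨-J x, neg_mem hx, by rw [map_neg, h.sq, neg_neg]⟩
  · rintro ⟨y, hy, rfl⟩
    rw [Submodule.mem_comap, h.sq]
    exact neg_mem hy

theorem finrank_comap (W : Submodule ℝ L) :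
    Module.finrank ℝ (W.comap J) = Module.finrank ℝ W := by
  have hJ : Function.Injective J := fun x y hxy => by
    rw [← neg_inj, ← h.sq, hxy, h.sq]
  rw [h.comap_eq_map, (Submodule.equivMapOfInjective J hJ W).finrank_eq]

theorem apply_complexCore_J_realPart {k c : L} (hk : k ∈ complexCore J)
    (hc : c ∈ realPart g J) : g k (J c) = 0 := by
  rw [h.isHermitianForm.apply_J, hc.2 _ (h.J_mem_complexCore hk), neg_zero]

variable [Module.Finite ℝ L]

theorem complexCore_sup_realPart : complexCore J ⊔ realPart g J = derivedSubspace L := by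
  have hcompl : IsCompl (complexCore J) (g.orthogonal (complexCore J)) := by
    have hrefl : g.IsRefl := fun x y hxy => by rw [h.symm, hxy]
    rw [LinearMap.BilinForm.isCompl_orthogonal_iff_disjoint hrefl, Submodule.disjoint_def]
    intro x hx hx'
    by_contra hne
    exact (h.pos x hne).ne' (hx' x hx)
  have hle : complexCore J ≤ derivedSubspace L := inf_le_left
  rw [realPart, inf_comm, ← sup_inf_assoc_of_le _ hle, hcompl.sup_eq_top, top_inf_eq]

theorem finrank_complexCore_add_finrank_realPart :
    Module.finrank ℝ (complexCore J) + Module.finrank ℝ (realPart g J) =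
      Module.finrank ℝ (derivedSubspace L) := by
  have hdisj : complexCore J ⊓ realPart g J = ⊥ :=
    (Submodule.disjoint_def.2 fun _ => h.eq_zero_of_mem).eq_bot
  rw [← Submodule.finrank_sup_add_finrank_inf_eq, hdisj, finrank_bot, add_zero,
    h.complexCore_sup_realPart]

end IsHermitian

end ComplexCore

section TwoStep

variable {L : Type*} [LieRing L] [LieAlgebra ℝ L]

/-- `(g, J)` is a Hermitian structure on a Lie algebra whose derived algebra is abelian. -/
structure IsTwoStepHermitian (g : LinearMap.BilinForm ℝ L) (J : L →ₗ[ℝ] L) : Prop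
    extends IsHermitian g J where
  two_step : LieAlgebra.derivedSeries ℝ L 2 = ⊥

variable {g : LinearMap.BilinForm ℝ L} {J : L →ₗ[ℝ] L}

namespace IsTwoStepHermitian

variable (h : IsTwoStepHermitian g J)
include h

theorem lie_eq_zero {x y : L} (hx : x ∈ derivedSubspace L) (hy : y ∈ derivedSubspace L) :
    ⁅x, y⁆ = 0 :=
  derivedSeries_two_eq_bot_iff.mp h.two_step x hx y hy

theorem lie_lie_comm (x y : L) {v : L} (hv : v ∈ derivedSubspace L) :
    ⁅x, ⁅y, v⁆⁆ = ⁅y, ⁅x, v⁆⁆ := by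
  rw [leibniz_lie x y v, h.lie_eq_zero (lie_mem_derivedSubspace x y) hv, zero_add]

theorem lie_J_J {x y : L} (hx : x ∈ derivedSubspace L) (hy : y ∈ derivedSubspace L) :
    ⁅J x, J y⁆ = J (⁅J x, y⁆ - ⁅J y, x⁆) := by
  have hN := h.integrable x y
  rw [h.lie_eq_zero hx hy, ← lie_skew x (J y), map_neg, sub_zero, sub_neg_eq_add] at hN
  rw [map_sub, ← sub_eq_zero, ← hN]
  abel

theorem lie_J_sub_lie_J_mem {x y : L} (hx : x ∈ derivedSubspace L)
    (hy : y ∈ derivedSubspace L) : ⁅J x, y⁆ - ⁅J y, x⁆ ∈ complexCore J :=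
  ⟨sub_mem (lie_mem_derivedSubspace _ _) (lie_mem_derivedSubspace _ _),
    show J _ ∈ derivedSubspace L from h.lie_J_J hx hy ▸ lie_mem_derivedSubspace _ _⟩

theorem lie_J_J_of_mem_complexCore {x k : L} (hx : x ∈ derivedSubspace L)
    (hk : k ∈ complexCore J) : ⁅J x, J k⁆ = J ⁅J x, k⁆ := by
  rw [h.lie_J_J hx hk.1, ← lie_skew (J k) x, h.lie_eq_zero hx hk.2, neg_zero, sub_zero]

theorem lie_J_mem_complexCore {x k : L} (hx : x ∈ derivedSubspace L) (hk : k ∈ complexCore J) :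
    ⁅J x, k⁆ ∈ complexCore J :=
  ⟨lie_mem_derivedSubspace _ _, show J _ ∈ derivedSubspace L from
    h.lie_J_J_of_mem_complexCore hx hk ▸ lie_mem_derivedSubspace _ _⟩

/-- The action of `J𝔞_r` on `𝔞_J` by the adjoint representation. -/
def coreAd : realPart g J →ₗ[ℝ] complexCore J →ₗ[ℝ] complexCore J :=
  LinearMap.mk₂ ℝ (fun x k => ⟨⁅J x, (k : L)⁆, h.lie_J_mem_complexCore x.2.1 k.2⟩)
    (fun x x' k => Subtype.ext (by simp)) (fun t x k => Subtype.ext (by simp))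
    (fun x k k' => Subtype.ext (by simp)) (fun t x k => Subtype.ext (by simp))

theorem coe_coreAd (x : realPart g J) (k : complexCore J) :
    (h.coreAd x k : L) = ⁅J x, (k : L)⁆ := rfl

theorem coreAd_commute (x y : realPart g J) : Commute (h.coreAd x) (h.coreAd y) :=
  LinearMap.ext fun k => Subtype.ext (h.lie_lie_comm _ _ k.2.1)

theorem torsionForm_J {u y y' : L} (hu : u ∈ derivedSubspace L) (hy : y ∈ complexCore J)
    (hy' : y' ∈ complexCore J) :
    torsionForm g J u (J y) y' = -(g ⁅J u, y⁆ y' + g ⁅J u, y'⁆ y) := by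
  rw [torsionForm_eq h.orthogonal, h.sq, ← lie_skew (J y') (J u),
    h.lie_J_J_of_mem_complexCore hu hy', neg_lie, h.lie_eq_zero hy.1 hy'.2, lie_neg]
  simp only [map_neg, LinearMap.neg_apply, h.orthogonal, neg_zero, map_zero, LinearMap.zero_apply]
  ring

theorem core_relation (hT : ∀ x y z w, extDeriv₃ (torsionForm g J) x y z w = 0) {x v y y' : L}
    (hx : x ∈ derivedSubspace L) (hv : v ∈ derivedSubspace L)
    (hy : y ∈ complexCore J) (hy' : y' ∈ complexCore J) :
    (g ⁅J ⁅J x, v⁆, y⁆ y' + g ⁅J ⁅J x, v⁆, y'⁆ y)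
      + (g ⁅J v, ⁅J x, y⁆⁆ y' + g ⁅J v, y'⁆ ⁅J x, y⁆)
      + (g ⁅J v, y⁆ ⁅J x, y'⁆ + g ⁅J v, ⁅J x, y'⁆⁆ y) = 0 := by
  have hxy := h.lie_J_mem_complexCore hx hy
  have hxy' := h.lie_J_mem_complexCore hx hy'
  have hzero := torsionForm_zero_left h.orthogonal
  have hT := hT (J x) v (J y) y'
  rw [extDeriv₃, h.lie_eq_zero hv hy.2, h.lie_eq_zero hv hy'.1, h.lie_eq_zero hy.2 hy'.1,
    hzero, hzero, hzero,
    h.lie_J_J_of_mem_complexCore hx hy, h.torsionForm_J (lie_mem_derivedSubspace _ _) hy hy',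
    torsionForm_swap_left h.orthogonal (J _), h.torsionForm_J hv hxy hy',
    torsionForm_swap_left h.orthogonal _ v, torsionForm_swap_right h.orthogonal v,
    h.torsionForm_J hv hy hxy'] at hT
  linarith

theorem lie_J_eq_of_sub_mem {p q k : L} (hpq : p - q ∈ complexCore J)
    (hk : k ∈ derivedSubspace L) : ⁅J p, k⁆ = ⁅J q, k⁆ := by
  rw [← sub_eq_zero, ← sub_lie, ← map_sub]
  exact h.lie_eq_zero hpq.2 hk

end IsTwoStepHermitian

end TwoStep

section Splitting

variable {L : Type*} [LieRing L] [LieAlgebra ℝ L]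

/-- A two-step Hermitian Lie algebra with `𝔤 = 𝔤' + J𝔤'`; then `𝔤 = 𝔞_J ⊕ 𝔞_r ⊕ J𝔞_r`. -/
structure IsSplitTwoStepHermitian (g : LinearMap.BilinForm ℝ L) (J : L →ₗ[ℝ] L) : Prop
    extends IsTwoStepHermitian g J where
  derived_sup_comap_eq_top : derivedSubspace L ⊔ (derivedSubspace L).comap J = ⊤

variable {g : LinearMap.BilinForm ℝ L} {J : L →ₗ[ℝ] L}

variable (g J) in
/-- The map `(k, c, u) ↦ k + c + Ju` from `𝔞_J ⊕ 𝔞_r ⊕ 𝔞_r`. -/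
def splittingMap : complexCore J × realPart g J × realPart g J →ₗ[ℝ] L :=
  (complexCore J).subtype.coprod
    ((realPart g J).subtype.coprod (J ∘ₗ (realPart g J).subtype))

theorem splittingMap_apply (k : complexCore J) (c u : realPart g J) :
    splittingMap g J (k, c, u) = k + (c + J u) := rfl

theorem IsHermitian.splittingMap_injective (h : IsHermitian g J) :
    Function.Injective (splittingMap g J) := by
  rw [injective_iff_map_eq_zero]
  rintro ⟨k, c, u⟩ hp
  rw [splittingMap_apply] at hp
  have hJu : J u ∈ derivedSubspace L := by
    rw [← Submodule.add_mem_iff_right _ c.2.1, ← Submodule.add_mem_iff_right _ k.2.1, hp]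
    exact zero_mem _
  obtain rfl : u = 0 := Subtype.ext (h.eq_zero_of_mem ⟨u.2.1, hJu⟩ u.2)
  rw [ZeroMemClass.coe_zero, map_zero, add_zero] at hp
  obtain rfl : c = 0 := Subtype.ext <| h.eq_zero_of_mem
    (by rw [eq_neg_of_add_eq_zero_right hp]; exact neg_mem k.2) c.2
  rw [ZeroMemClass.coe_zero, add_zero, ZeroMemClass.coe_eq_zero] at hp
  rw [hp]
  rfl

namespace IsSplitTwoStepHermitian

variable [Module.Finite ℝ L]

theorem splittingMap_surjective (h : IsSplitTwoStepHermitian g J) :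
    Function.Surjective (splittingMap g J) := by
  intro x
  obtain ⟨v, hv, v', hv', rfl⟩ := Submodule.mem_sup.1
    (h.derived_sup_comap_eq_top ▸ Submodule.mem_top : x ∈ _ ⊔ (derivedSubspace L).comap J)
  rw [Submodule.mem_comap] at hv'
  rw [← h.complexCore_sup_realPart] at hv hv'
  obtain ⟨k, hk, c, hc, rfl⟩ := Submodule.mem_sup.1 hv
  obtain ⟨k', hk', u, hu, hv'⟩ := Submodule.mem_sup.1 hv'
  have hv' : v' = -J k' + J (-u) := by
    rw [← neg_eq_iff_eq_neg.2 (h.sq v'), ← hv', map_neg, map_add, neg_add]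
  refine ⟨(⟨k, hk⟩ + -⟨J k', h.J_mem_complexCore hk'⟩, ⟨c, hc⟩, -⟨u, hu⟩), ?_⟩
  rw [splittingMap_apply, hv']
  push_cast
  abel

/-- The splitting `𝔤 = 𝔞_J ⊕ 𝔞_r ⊕ J𝔞_r`. -/
noncomputable def splitting (h : IsSplitTwoStepHermitian g J) :
    (complexCore J × realPart g J × realPart g J) ≃ₗ[ℝ] L :=
  LinearEquiv.ofBijective (splittingMap g J) ⟨h.splittingMap_injective, h.splittingMap_surjective⟩

/-- The `𝔞_J`-component of an element of `𝔤 = 𝔞_J ⊕ 𝔞_r ⊕ J𝔞_r`. -/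
noncomputable def coreProj (h : IsSplitTwoStepHermitian g J) : L →ₗ[ℝ] complexCore J :=
  LinearMap.fst ℝ _ _ ∘ₗ h.splitting.symm.toLinearMap

/-- The `𝔞_r`-component of an element of `𝔤 = 𝔞_J ⊕ 𝔞_r ⊕ J𝔞_r`. -/
noncomputable def realProj (h : IsSplitTwoStepHermitian g J) : L →ₗ[ℝ] realPart g J :=
  LinearMap.fst ℝ _ _ ∘ₗ LinearMap.snd ℝ _ _ ∘ₗ h.splitting.symm.toLinearMap

/-- The `𝔞_J`-component of `[JX, W]` for `X, W` in `𝔞_r`; it corresponds to `h`. -/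
noncomputable def coreProduct (h : IsSplitTwoStepHermitian g J) :
    realPart g J →ₗ[ℝ] realPart g J →ₗ[ℝ] complexCore J :=
  LinearMap.mk₂ ℝ (fun x y => h.coreProj ⁅J x, (y : L)⁆)
    (fun x x' y => by simp) (fun t x y => by simp) (fun x y y' => by simp) (fun t x y => by simp)

/-- The `𝔞_r`-component of `[JX, W]` for `X, W` in `𝔞_r`; it corresponds to `f`. -/
noncomputable def product (h : IsSplitTwoStepHermitian g J) :
    realPart g J →ₗ[ℝ] realPart g J →ₗ[ℝ] realPart g J :=
  LinearMap.mk₂ ℝ (fun x y => h.realProj ⁅J x, (y : L)⁆)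
    (fun x x' y => by simp) (fun t x y => by simp) (fun x y y' => by simp) (fun t x y => by simp)

variable (h : IsSplitTwoStepHermitian g J)
include h

theorem splitting_apply (k : complexCore J) (c u : realPart g J) :
    h.splitting (k, c, u) = k + (c + J u) := rfl

theorem realProj_splitting (k : complexCore J) (c u : realPart g J) :
    h.realProj (h.splitting (k, c, u)) = c :=
  congrArg (fun p => p.2.1) (h.splitting.symm_apply_apply (k, c, u))

theorem coreProj_splitting (k : complexCore J) (c u : realPart g J) :
    h.coreProj (h.splitting (k, c, u)) = k :=
  congrArg (fun p => p.1) (h.splitting.symm_apply_apply (k, c, u))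

theorem realProj_coe_realPart (c : realPart g J) : h.realProj c = c := by
  have hc : (c : L) = h.splitting (0, c, 0) := by
    rw [splitting_apply, ZeroMemClass.coe_zero, ZeroMemClass.coe_zero, map_zero, add_zero, zero_add]
  rw [hc, h.realProj_splitting]

theorem realProj_coe_complexCore {k : L} (hk : k ∈ complexCore J) : h.realProj k = 0 := by
  have hk : k = h.splitting (⟨k, hk⟩, 0, 0) := by
    rw [splitting_apply, ZeroMemClass.coe_zero, map_zero, add_zero, add_zero]
  rw [hk, h.realProj_splitting]

theorem coreProj_add_realProj {v : L} (hv : v ∈ derivedSubspace L) :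
    (h.coreProj v : L) + h.realProj v = v := by
  rw [← h.complexCore_sup_realPart] at hv
  obtain ⟨k, hk, c, hc, rfl⟩ := Submodule.mem_sup.1 hv
  have hkc : k + c = h.splitting (⟨k, hk⟩, ⟨c, hc⟩, 0) := by
    rw [splitting_apply, ZeroMemClass.coe_zero, map_zero, add_zero]
  rw [hkc, h.coreProj_splitting, h.realProj_splitting]
  exact hkc

theorem lie_J_eq (x y : realPart g J) :
    ⁅J x, (y : L)⁆ = h.coreProduct x y + h.product x y :=
  (h.coreProj_add_realProj (lie_mem_derivedSubspace _ _)).symm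

theorem product_comm (x y : realPart g J) : h.product x y = h.product y x := by
  rw [← sub_eq_zero]
  exact (map_sub h.realProj _ _).symm.trans
    (h.realProj_coe_complexCore (h.lie_J_sub_lie_J_mem x.2.1 y.2.1))

theorem product_realProj (x : realPart g J) {v : L} (hv : v ∈ derivedSubspace L) :
    h.product x (h.realProj v) = h.realProj ⁅J x, v⁆ := by
  conv_rhs => rw [← h.coreProj_add_realProj hv, lie_add, map_add,
    h.realProj_coe_complexCore (h.lie_J_mem_complexCore x.2.1 (h.coreProj v).2), zero_add]
  rfl

theorem product_left_comm (x y z : realPart g J) :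
    h.product x (h.product y z) = h.product y (h.product x z) := by
  have product_product (x y : realPart g J) :
      h.product x (h.product y z) = h.realProj ⁅J x, ⁅J y, (z : L)⁆⁆ :=
    h.product_realProj x (lie_mem_derivedSubspace _ _)
  rw [product_product, product_product, h.lie_lie_comm _ _ z.2.1]

theorem product_right_comm (x y z : realPart g J) :
    h.product (h.product x y) z = h.product (h.product x z) y := by
  rw [h.product_comm _ z, h.product_comm x y, h.product_left_comm, h.product_comm z x,
    h.product_comm y]

theorem coreAd_coreAd_relation
    (hT : ∀ x y z w, extDeriv₃ (torsionForm g J) x y z w = 0) (x : realPart g J)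
    (k k' : complexCore J) :
    g (h.coreAd x (h.coreAd x k)) k' + 2 * g (h.coreAd x k) (h.coreAd x k')
      + g k (h.coreAd x (h.coreAd x k'))
      + (g (h.coreAd (h.product x x) k) k' + g k (h.coreAd (h.product x x) k')) = 0 := by
  have hprod : ⁅J x, (x : L)⁆ - h.product x x ∈ complexCore J := by
    rw [h.lie_J_eq, add_sub_cancel_right]
    exact (h.coreProduct x x).2
  have hr := h.core_relation hT x.2.1 x.2.1 k.2 k'.2
  rw [h.lie_J_eq_of_sub_mem hprod k.2.1, h.lie_J_eq_of_sub_mem hprod k'.2.1,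
    h.symm _ (k : L), h.symm ⁅J x, (k' : L)⁆, h.symm _ (k : L)] at hr
  simp only [h.coe_coreAd]
  linear_combination hr

theorem lie_splitting (k k' : complexCore J) (c c' u u' : realPart g J) :
    ⁅h.splitting (k, c, u), h.splitting (k', c', u')⁆ =
      h.splitting (h.coreAd u k' - h.coreAd u' k + (h.coreProduct u c' - h.coreProduct u' c)
        + J.restrict (fun _ => h.J_mem_complexCore) (h.coreProduct u u' - h.coreProduct u' u),
        h.product u c' - h.product u' c, 0) := by
  have hUU : ⁅J (u : L), J (u' : L)⁆ = J (h.coreProduct u u' - h.coreProduct u' u) := by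
    rw [h.lie_J_J u.2.1 u'.2.1, h.lie_J_eq, h.lie_J_eq, h.product_comm u', add_sub_add_right_eq_sub]
  have hRR : ⁅(k : L) + c, (k' : L) + c'⁆ = 0 :=
    h.lie_eq_zero (add_mem k.2.1 c.2.1) (add_mem k'.2.1 c'.2.1)
  rw [h.splitting_apply, h.splitting_apply, h.splitting_apply, ← add_assoc, ← add_assoc, add_lie,
    lie_add, lie_add (J _), hRR, hUU, zero_add, ← lie_skew _ (J (u' : L)), lie_add, lie_add,
    h.lie_J_eq, h.lie_J_eq]
  push_cast
  rw [h.coe_coreAd, h.coe_coreAd, map_zero]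
  simp only [map_sub, AddSubgroupClass.coe_sub, LinearMap.coe_restrict_apply]
  abel

theorem metric_splitting (k k' : complexCore J) (c c' u u' : realPart g J) :
    g (h.splitting (k, c, u)) (h.splitting (k', c', u')) =
      g k k' + g c c' + g u u' + g (J u) c' + g (J u') c := by
  have hkc (k : complexCore J) (c : realPart g J) : g (k : L) c = 0 := c.2.2 k k.2
  have hkJ (k : complexCore J) (c : realPart g J) : g (k : L) (J c) = 0 :=
    h.apply_complexCore_J_realPart k.2 c.2
  rw [splitting_apply, splitting_apply]
  simp only [map_add, LinearMap.add_apply, h.orthogonal, hkc, hkJ, h.symm _ (k' : L),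
    h.symm (c : L) (J u')]
  ring

theorem J_splitting (k : complexCore J) (c u : realPart g J) :
    J (h.splitting (k, c, u)) =
      h.splitting (J.restrict (fun _ => h.J_mem_complexCore) k, -u, c) := by
  rw [splitting_apply, splitting_apply, map_add, map_add, h.sq, LinearMap.coe_restrict_apply,
    Submodule.coe_neg, add_comm (J c)]

theorem span_product : Submodule.span ℝ {z | ∃ x y, h.product x y = z} = ⊤ := by
  have hle : derivedSubspace L ≤
      (Submodule.span ℝ {z | ∃ x y, h.product x y = z}).comap h.realProj := by
    refine derivedSubspace_le fun x y => ?_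
    obtain ⟨⟨k, c, u⟩, rfl⟩ := h.splitting.surjective x
    obtain ⟨⟨k', c', u'⟩, rfl⟩ := h.splitting.surjective y
    rw [Submodule.mem_comap, h.lie_splitting, h.realProj_splitting]
    exact sub_mem (Submodule.subset_span ⟨u, c', rfl⟩) (Submodule.subset_span ⟨u', c, rfl⟩)
  refine Submodule.eq_top_iff'.2 fun c => ?_
  rw [← h.realProj_coe_realPart c]
  exact hle c.2.1

theorem exists_product_eq_self : ∃ e, ∀ x, h.product e x = x := by
  let : Mul (realPart g J) := ⟨fun x y => h.product x y⟩
  let : NonUnitalCommRing (realPart g J) :=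
    { left_distrib := fun x => map_add (h.product x)
      right_distrib := fun x y z => by
        change h.product (x + y) z = h.product x z + h.product y z
        rw [map_add, LinearMap.add_apply]
      zero_mul := fun x => by
        change h.product 0 x = 0
        rw [map_zero, LinearMap.zero_apply]
      mul_zero := fun x => map_zero (h.product x)
      mul_comm := h.product_comm
      mul_assoc := fun x y z => by
        change h.product (h.product x y) z = h.product x (h.product y z)
        rw [h.product_right_comm, h.product_comm _ y, h.product_left_comm, h.product_comm y,
          h.product_comm x] }
  have : IsScalarTower ℝ (realPart g J) (realPart g J) :=
    ⟨fun t x y => LinearMap.map_smul₂ h.product t x y⟩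
  have : SMulCommClass ℝ (realPart g J) (realPart g J) :=
    ⟨fun t x y => (map_smul (h.product x) t y).symm⟩
  exact exists_forall_mul_eq_self (R := ℝ) h.span_product

end IsSplitTwoStepHermitian

end Splitting

section Dimension

variable {L : Type*} [LieRing L] [LieAlgebra ℝ L]
  {g : LinearMap.BilinForm ℝ L} {J : L →ₗ[ℝ] L}

namespace IsTwoStepSKTNonComplexCodimTwo

variable (h : IsTwoStepSKTNonComplexCodimTwo g J)
include h

theorem complexCore_lt_derivedSubspace : complexCore J < derivedSubspace L :=
  inf_le_left.lt_of_ne fun hcore => h.non_complex <| by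
    rwa [IsComplexSubspace, ← h.skt.comap_eq_map]

variable [Module.Finite ℝ L]

theorem finrank_derivedSubspace_eq :
    Module.finrank ℝ (derivedSubspace L) = Module.finrank ℝ (complexCore J) + 2 := by
  have hL := (derivedSubspace L).finrank_quotient_add_finrank
  have hsum := Submodule.finrank_sup_add_finrank_inf_eq (derivedSubspace L)
    ((derivedSubspace L).comap J)
  have hsup := Submodule.finrank_le (derivedSubspace L ⊔ (derivedSubspace L).comap J)
  have hlt := Submodule.finrank_lt_finrank_of_lt h.complexCore_lt_derivedSubspace
  have hcore := (h.skt.isHermitianForm.restrict fun _ => h.skt.J_mem_complexCore).even_finrank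
  have heven := h.skt.isHermitianForm.even_finrank
  rw [h.codim_two] at hL
  rw [h.skt.finrank_comap] at hsum
  rw [← hL] at heven hsup
  change _ + Module.finrank ℝ (complexCore J) = _ at hsum
  grind

theorem finrank_realPart : Module.finrank ℝ (realPart g J) = 2 := by
  have hsum := h.skt.finrank_complexCore_add_finrank_realPart
  rw [h.finrank_derivedSubspace_eq] at hsum
  omega

theorem finrank_eq : Module.finrank ℝ L = Module.finrank ℝ (complexCore J) + 4 := by
  rw [← (derivedSubspace L).finrank_quotient_add_finrank, h.codim_two,
    h.finrank_derivedSubspace_eq]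
  ring

theorem isSplitTwoStepHermitian : IsSplitTwoStepHermitian g J where
  toIsHermitian := h.skt.toIsHermitian
  two_step := h.two_step
  derived_sup_comap_eq_top := by
    have hsum := Submodule.finrank_sup_add_finrank_inf_eq (derivedSubspace L)
      ((derivedSubspace L).comap J)
    rw [h.skt.finrank_comap, h.finrank_derivedSubspace_eq] at hsum
    change _ + Module.finrank ℝ (complexCore J) = _ at hsum
    refine Submodule.eq_top_of_finrank_eq ?_
    rw [h.finrank_eq]
    omega

end IsTwoStepSKTNonComplexCodimTwo

end Dimension

/-! ### Adapted charts -/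

section Transport

variable {L L' : Type*} [LieRing L] [LieAlgebra ℝ L] [LieRing L'] [LieAlgebra ℝ L']
  {g : LinearMap.BilinForm ℝ L} {J : L →ₗ[ℝ] L}
  {g' : LinearMap.BilinForm ℝ L'} {J' : L' →ₗ[ℝ] L'}

theorem AreIsomorphic.extDeriv₃_torsionForm_eq_zero (h : AreIsomorphic g J g' J')
    (hT : ∀ x y z w, extDeriv₃ (torsionForm g J) x y z w = 0) (x y z w : L') :
    extDeriv₃ (torsionForm g' J') x y z w = 0 := by
  obtain ⟨e, hg, hJ⟩ := h
  have torsionForm_map (x y z : L) :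
      torsionForm g' J' (e x) (e y) (e z) = torsionForm g J x y z := by
    simp only [torsionForm, extDeriv₂, fundamentalForm, ← hJ, ← LieEquiv.map_lie, hg]
  have extDeriv₃_map (x y z w : L) :
      extDeriv₃ (torsionForm g' J') (e x) (e y) (e z) (e w) = 0 := by
    rw [← hT x y z w]
    simp only [extDeriv₃, ← LieEquiv.map_lie, torsionForm_map]
  simpa only [e.apply_symm_apply] using
    extDeriv₃_map (e.symm x) (e.symm y) (e.symm z) (e.symm w)

theorem map_mem_derivedSubspace (e : L ≃ₗ⁅ℝ⁆ L') {x : L} (hx : x ∈ derivedSubspace L) :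
    e x ∈ derivedSubspace L' := by
  have hle : derivedSubspace L ≤ (derivedSubspace L').comap (e : L →ₗ[ℝ] L') :=
    derivedSubspace_le fun x y => by
      change e ⁅x, y⁆ ∈ derivedSubspace L'
      rw [LieEquiv.map_lie]
      exact lie_mem_derivedSubspace _ _
  exact hle hx

end Transport

section AdaptedChart

variable {L : Type*} [LieRing L] [LieAlgebra ℝ L] [Module.Finite ℝ L]
  {g : LinearMap.BilinForm ℝ L} {J : L →ₗ[ℝ] L} (h : IsSplitTwoStepHermitian g J)
  {m : ℕ} {V : Type*} [AddCommGroup V] [Module ℝ V]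

variable (m V) in
/-- Coordinates `𝔞_J ≃ ℂ^m` and `𝔞_r ≃ V` in which the action of `J𝔞_r` on `𝔞_J` is diagonal. -/
structure AdaptedChart where
  φ : complexCore J ≃ₗ[ℝ] (Fin m → ℂ)
  κ : realPart g J ≃ₗ[ℝ] V
  α : Fin m → V →ₗ[ℝ] ℂ
  φ_J : ∀ k, φ (J.restrict (fun _ => h.J_mem_complexCore) k) = Complex.I • φ k
  metric_eq : ∀ k k' : complexCore J, g k k' = Data.innerJ (φ k) (φ k')
  φ_coreAd : ∀ x k i, φ (h.coreAd x k) i = α i (κ x) * φ k i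

namespace AdaptedChart

variable {h} (F : AdaptedChart h m V)

/-- The identification of `𝔤 = 𝔞_J ⊕ 𝔞_r ⊕ J𝔞_r` with `ℂ^m ⊕ V ⊕ V`. -/
noncomputable def equiv : L ≃ₗ[ℝ] Space m V :=
  h.splitting.symm.trans (F.φ.prodCongr (F.κ.prodCongr F.κ))

theorem equiv_splitting (k : complexCore J) (c u : realPart g J) :
    F.equiv (h.splitting (k, c, u)) = (F.φ k, F.κ c, F.κ u) :=
  congrArg (F.φ.prodCongr (F.κ.prodCongr F.κ)) (h.splitting.symm_apply_apply (k, c, u))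

/-- The data `(f, h, α)` of the Lie algebra in an adapted chart. -/
noncomputable def toData : Data m V where
  f := (h.product.compl₁₂ F.κ.symm.toLinearMap F.κ.symm.toLinearMap).compr₂ F.κ.toLinearMap
  h := (h.coreProduct.compl₁₂ F.κ.symm.toLinearMap F.κ.symm.toLinearMap).compr₂ F.φ.toLinearMap
  α := F.α
  g₀ := (g.restrict (realPart g J)).compl₁₂ F.κ.symm.toLinearMap F.κ.symm.toLinearMap
  τ₀ := (g.compl₁₂ (J ∘ₗ (realPart g J).subtype) (realPart g J).subtype).compl₁₂
    F.κ.symm.toLinearMap F.κ.symm.toLinearMap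
  f_symm x y := congrArg F.κ (h.product_comm _ _)
  f_f_symm x y z := by
    change F.κ (h.product (F.κ.symm (F.κ (h.product (F.κ.symm x) (F.κ.symm y)))) (F.κ.symm z)) =
      F.κ (h.product (F.κ.symm (F.κ (h.product (F.κ.symm x) (F.κ.symm z)))) (F.κ.symm y))
    rw [F.κ.symm_apply_apply, F.κ.symm_apply_apply, h.product_right_comm]
  g₀_symm x y := h.symm _ _
  τ₀_skew x y := by
    change g (J (F.κ.symm x)) (F.κ.symm y) = -g (J (F.κ.symm y)) (F.κ.symm x)
    rw [← h.isHermitianForm.apply_J, h.symm]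
  pos x u hxu := by
    have hne : h.splitting (0, F.κ.symm x, F.κ.symm u) ≠ 0 := by
      simpa only [ne_eq, LinearEquiv.map_eq_zero_iff, Prod.mk_eq_zero, true_and, not_and_or]
        using hxu
    have hp := h.pos _ hne
    rw [h.metric_splitting, ZeroMemClass.coe_zero, map_zero, zero_add] at hp
    change 0 < g (F.κ.symm x) (F.κ.symm x) + g (F.κ.symm u) (F.κ.symm u)
      + 2 * g (J (F.κ.symm u)) (F.κ.symm x)
    linarith

theorem toData_f (x y : realPart g J) :
    F.toData.f (F.κ x) (F.κ y) = F.κ (h.product x y) := by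
  simp [toData]

theorem toData_h (x y : realPart g J) :
    F.toData.h (F.κ x) (F.κ y) = F.φ (h.coreProduct x y) := by
  simp [toData]

theorem toData_g₀ (x y : realPart g J) : F.toData.g₀ (F.κ x) (F.κ y) = g x y := by
  simp [toData]

theorem toData_τ₀ (x y : realPart g J) : F.toData.τ₀ (F.κ x) (F.κ y) = g (J x) y := by
  simp [toData]

theorem equiv_lie (x y : L) : F.equiv ⁅x, y⁆ = F.toData.bracket (F.equiv x) (F.equiv y) := by
  obtain ⟨⟨k, c, u⟩, rfl⟩ := h.splitting.surjective x
  obtain ⟨⟨k', c', u'⟩, rfl⟩ := h.splitting.surjective y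
  rw [h.lie_splitting, F.equiv_splitting, F.equiv_splitting, F.equiv_splitting]
  refine Prod.ext (funext fun i => ?_) (Prod.ext ?_ (map_zero _))
  · simp only [Data.bracket, Data.h₂, toData_h, map_add, map_sub, F.φ_J, F.φ_coreAd, Pi.add_apply,
      Pi.sub_apply, Pi.smul_apply, smul_eq_mul]
    change _ = F.α i _ * _ - F.α i _ * _ + _ - _ + _
    ring
  · simp only [Data.bracket, toData_f, map_sub]

theorem metric_equiv (x y : L) : F.toData.spaceMetric (F.equiv x) (F.equiv y) = g x y := by
  obtain ⟨⟨k, c, u⟩, rfl⟩ := h.splitting.surjective x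
  obtain ⟨⟨k', c', u'⟩, rfl⟩ := h.splitting.surjective y
  rw [F.equiv_splitting, F.equiv_splitting, Data.spaceMetric_mk, h.metric_splitting, F.metric_eq,
    F.toData_g₀, F.toData_g₀, F.toData_τ₀, F.toData_τ₀]

theorem equiv_J (x : L) : F.equiv (J x) = Data.spaceI m V (F.equiv x) := by
  obtain ⟨⟨k, c, u⟩, rfl⟩ := h.splitting.surjective x
  rw [h.J_splitting, F.equiv_splitting, F.equiv_splitting, F.φ_J, map_neg]
  rfl

theorem jacobi : F.toData.Jacobi := by
  intro p q r
  obtain ⟨x, rfl⟩ := F.equiv.surjective p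
  obtain ⟨y, rfl⟩ := F.equiv.surjective q
  obtain ⟨z, rfl⟩ := F.equiv.surjective r
  simp only [← F.equiv_lie, ← map_add]
  exact congrArg F.equiv (leibniz_lie x y z)

/-- The isomorphism of the Lie algebra with its model. -/
noncomputable def lieEquiv : L ≃ₗ⁅ℝ⁆ F.toData.Model F.jacobi :=
  { F.equiv with map_lie' := F.equiv_lie _ _ }

theorem areIsomorphic :
    AreIsomorphic g J (Data.metric F.jacobi) (Data.complexStructure F.jacobi) :=
  ⟨F.lieEquiv, F.metric_equiv, F.equiv_J⟩

theorem torsionDeriv_eq_zero (hT : ∀ x y z w, extDeriv₃ (torsionForm g J) x y z w = 0) :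
    Data.torsionDeriv F.jacobi = 0 := by
  ext v
  exact F.areIsomorphic.extDeriv₃_torsionForm_eq_zero hT _ _ _ _

theorem ofJ_mem_derivedSubspace (y : Fin m → ℂ) :
    Data.ofJ F.jacobi y ∈ derivedSubspace (F.toData.Model F.jacobi) := by
  have hy : F.lieEquiv (F.φ.symm y) = Data.ofJ F.jacobi y := by
    have h₁ := F.equiv_splitting (F.φ.symm y) 0 0
    rw [h.splitting_apply, ZeroMemClass.coe_zero, map_zero, add_zero, add_zero, map_zero,
      F.φ.apply_symm_apply] at h₁
    exact h₁
  rw [← hy]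
  exact map_mem_derivedSubspace _ (F.φ.symm y).2.1

end AdaptedChart

end AdaptedChart

section NormalChart

variable {L : Type*} [LieRing L] [LieAlgebra ℝ L] [Module.Finite ℝ L]
  {g : LinearMap.BilinForm ℝ L} {J : L →ₗ[ℝ] L}

theorem IsSplitTwoStepHermitian.exists_adaptedChart (h : IsSplitTwoStepHermitian g J)
    (hT : ∀ x y z w, extDeriv₃ (torsionForm g J) x y z w = 0)
    (X : Module.Basis (Fin 2) ℝ (realPart g J)) {a b₁ b₂ : ℝ}
    (h₁ : h.product (X 0) (X 0) = a • X 0)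
    (h₂ : h.product (X 1) (X 1) = b₁ • X 0 + b₂ • X 1) :
    ∃ (m : ℕ) (F : AdaptedChart h m (Fin 2 → ℝ)), F.κ = X.equivFun := by
  have coreAd_J (x : realPart g J) (k : complexCore J) :
      h.coreAd x (J.restrict (fun _ => h.J_mem_complexCore) k) =
        J.restrict (fun _ => h.J_mem_complexCore) (h.coreAd x k) :=
    Subtype.ext (h.lie_J_J_of_mem_complexCore x.2.1 k.2)
  obtain ⟨m, φ, z, w, hJ, hg, hz, hw⟩ := IsHermitianForm.exists_diagonalizing_coordinates
    (h.isHermitianForm.restrict fun _ => h.J_mem_complexCore) (coreAd_J (X 0)) (coreAd_J (X 1))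
    (h.coreAd_commute _ _) (a := a) (b₁ := b₁) (b₂ := b₂)
    (fun k k' => by
      have h := h.coreAd_coreAd_relation hT (X 0) k k'
      simp only [h₁, map_smul, LinearMap.smul_apply, Submodule.coe_smul, smul_eq_mul,
        ← mul_add] at h
      exact h)
    (fun k k' => by
      have h := h.coreAd_coreAd_relation hT (X 1) k k'
      simp only [h₂, map_add, map_smul, LinearMap.add_apply, LinearMap.smul_apply,
        Submodule.coe_add, Submodule.coe_smul, smul_eq_mul] at h
      simp only [LinearMap.BilinForm.restrict_apply, LinearMap.domRestrict_apply]
      linear_combination h)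
  refine ⟨m, ⟨φ, X.equivFun, fun i => (LinearMap.proj 0).smulRight (z i) +
    (LinearMap.proj 1).smulRight (w i), hJ, hg, fun x k i => ?_⟩, rfl⟩
  have hx : h.coreAd x k = X.equivFun x 0 • h.coreAd (X 0) k
      + X.equivFun x 1 • h.coreAd (X 1) k := by
    conv_lhs => rw [← X.sum_equivFun x, Fin.sum_univ_two]
    simp only [map_add, map_smul, LinearMap.add_apply, LinearMap.smul_apply]
  simp only [hx, map_add, map_smul, Pi.add_apply, Pi.smul_apply, hz, hw, LinearMap.add_apply,
    LinearMap.smulRight_apply, LinearMap.proj_apply, Complex.real_smul]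
  ring

namespace IsTwoStepSKTNonComplexCodimTwo

variable (h : IsTwoStepSKTNonComplexCodimTwo g J)
include h

theorem exists_isNormalFrame :
    ∃ (m : ℕ) (F : AdaptedChart h.isSplitTwoStepHermitian m (Fin 2 → ℝ)) (a b₁ b₂ : ℝ),
      IsNormalFrame F.toData (Pi.basisFun ℝ (Fin 2)) a b₁ b₂ := by
  obtain ⟨e, he⟩ := h.isSplitTwoStepHermitian.exists_product_eq_self
  obtain ⟨X, a, b₁, b₂, horth, ha, hb₂, h₁, h₂⟩ := exists_normal_basis
    (g := g.restrict (realPart g J)) (fun x y => h.skt.symm x y)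
    (fun x hx => h.skt.pos x (Subtype.coe_ne_coe.2 hx)) h.finrank_realPart he
  obtain ⟨m, F, hF⟩ :=
    h.isSplitTwoStepHermitian.exists_adaptedChart h.skt.torsion_closed X (h₁ _) h₂
  have hX (j : Fin 2) : Pi.basisFun ℝ (Fin 2) j = F.κ (X j) := by
    rw [hF, X.equivFun_apply, X.repr_self, Pi.basisFun_apply, Finsupp.single_eq_pi_single]
  refine ⟨m, F, a, b₁, b₂, fun j k => ?_, ha, hb₂, fun j => ?_, ?_⟩
  · rw [hX, hX, F.toData_g₀]
    exact horth j k
  · rw [hX, hX, F.toData_f, h₁, map_smul]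
  · rw [hX, hX, F.toData_f, h₂, map_add, map_smul, map_smul]

theorem isNormalForm {m : ℕ} {V : Type*} [AddCommGroup V] [Module ℝ V]
    {F : AdaptedChart h.isSplitTwoStepHermitian m V} {X : Module.Basis (Fin 2) ℝ V}
    {a b₁ b₂ : ℝ} (hF : IsNormalFrame F.toData X a b₁ b₂) :
    IsNormalForm F.toData X a b₁ b₂ (fun i => F.α i (X 0)) (fun i => F.α i (X 1)) :=
  hF.isNormalForm_iff.2 ⟨F.jacobi,
    Data.PluriclosedEquations.of_torsionDeriv_eq_zero _
      (F.torsionDeriv_eq_zero h.skt.torsion_closed) X,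
    fun _ => Data.α_ne_zero_of_ofJ_mem_derivedSubspace _ hF.a_pos.ne' hF.f_X₁_apply
      (F.ofJ_mem_derivedSubspace _)⟩

end IsTwoStepSKTNonComplexCodimTwo

end NormalChart

end SKT

theorem mainTheorem4 :
    -- every such algebra of dimension `2n` is some `𝔤_{f,h,α}` in normal form
    (∀ (n : ℕ) (L : Type*) [LieRing L] [LieAlgebra ℝ L] [Module.Finite ℝ L]
        (g : LinearMap.BilinForm ℝ L) (J : L →ₗ[ℝ] L),
        Module.finrank ℝ L = 2 * n →
        SKT.IsTwoStepSKTNonComplexCodimTwo g J →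
        ∃ m : ℕ, n = m + 2 ∧
          ∃ (D : SKT.Data m (Fin 2 → ℝ)) (X : Module.Basis (Fin 2) ℝ (Fin 2 → ℝ))
            (a b₁ b₂ : ℝ) (z w : Fin m → ℂ),
            SKT.IsNormalForm D X a b₁ b₂ z w ∧
            ∃ hJ : D.Jacobi,
              SKT.AreIsomorphic g J (SKT.Data.metric hJ) (SKT.Data.complexStructure hJ)) ∧
    -- conversely, every `𝔤_{f,h,α}` in normal form is such an algebra
    (∀ (m : ℕ) (V : Type*) [AddCommGroup V] [Module ℝ V]
        (D : SKT.Data m V) (X : Module.Basis (Fin 2) ℝ V)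
        (a b₁ b₂ : ℝ) (z w : Fin m → ℂ),
        SKT.IsNormalForm D X a b₁ b₂ z w →
        ∃ hJ : D.Jacobi,
          Module.finrank ℝ (D.Model hJ) = 2 * (m + 2) ∧
          SKT.IsTwoStepSKTNonComplexCodimTwo
            (SKT.Data.metric hJ) (SKT.Data.complexStructure hJ)) ∧
    -- the third case only occurs if `b₁ ≥ -b₂² / (4a)`
    (∀ (m : ℕ) (V : Type*) [AddCommGroup V] [Module ℝ V]
        (D : SKT.Data m V) (X : Module.Basis (Fin 2) ℝ V)
        (a b₁ b₂ : ℝ) (z w : Fin m → ℂ),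
        SKT.IsNormalForm D X a b₁ b₂ z w →
        (∃ i, (z i).re = -a / 2) → b₁ ≥ -b₂ ^ 2 / (4 * a)) := by
  refine ⟨fun n L _ _ _ g J hn h => ?_,
    fun m V _ _ D X a b₁ b₂ z w hN =>
      hN.exists_isTwoStepSKTNonComplexCodimTwo.imp fun hJ h => ⟨SKT.Data.finrank_model hJ X, h⟩,
    fun m V _ _ D X a b₁ b₂ z w hN ⟨i, hi⟩ => hN.le_b₁ hi⟩
  obtain ⟨m, F, a, b₁, b₂, hF⟩ := h.exists_isNormalFrame
  have hdim := F.equiv.finrank_eq.trans (SKT.Data.finrank_model F.jacobi (Pi.basisFun ℝ (Fin 2)))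
  exact ⟨m, by omega, F.toData, Pi.basisFun ℝ (Fin 2), a, b₁, b₂, _, _, h.isNormalForm hF,
    F.jacobi, F.areIsomorphic⟩
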